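/- Let $D$ be a finite digraph without loops and multiple arcs, of order $n\ge 3$, and let $k\ge 0$ be an integer. The degree of a vertex is the sum of its out-degree and its in-degree. Suppose that $D$ is $2$-strong, i.e. $D$ is strongly connected and $D-v$ is strongly connected for every vertex $v$. Suppose further that $z$ is a vertex of $D$ such that each of the other $n-1$ vertices has degree at least $n+k$, while $z$ has degree at least $n-k-4$. If $D$ has a simple directed cycle through $z$ of length at least $n-k-2$ (directed cycles of length $2$ are allowed), then $D$ is Hamiltonian, i.e. it has a simple directed cycle containing every vertex of $D$. -/

import Mathlib

namespace Digraph

variable {V : Type*}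

/-- The digraph has no loops. -/
def Loopless (D : Digraph V) : Prop := ∀ v, ¬ D.Adj v v

open Classical in
/-- The set of out-neighbours of `x`. -/
noncomputable def outNeighbors [Fintype V] (D : Digraph V) (x : V) : Finset V :=
  {y | D.Adj x y}

open Classical in
/-- The set of in-neighbours of `x`. -/
noncomputable def inNeighbors [Fintype V] (D : Digraph V) (x : V) : Finset V :=
  {y | D.Adj y x}

/-- The degree of `x`: its out-degree plus its in-degree. -/
noncomputable def degree [Fintype V] (D : Digraph V) (x : V) : ℕ :=
  (D.outNeighbors x).card + (D.inNeighbors x).card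

/-- The subdigraph induced by a set of vertices. -/
def induce (D : Digraph V) (S : Set V) : Digraph S where
  Adj x y := D.Adj x y

/-- `D - A`: the subdigraph obtained by deleting the vertices of `A`. -/
def deleteVertices (D : Digraph V) (A : Finset V) : Digraph ((A : Set V)ᶜ : Set V) :=
  D.induce (A : Set V)ᶜ

/-- `p` lists the vertices of a simple directed path from `x` to `y`. -/
structure IsPath (D : Digraph V) (x y : V) (p : List V) : Prop where
  nodup : p.Nodup
  chain : p.IsChain D.Adj
  head : p.head? = some x
  last : p.getLast? = some y

/-- `D` is strong: any two distinct vertices are joined by paths in both directions. -/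
def IsStrong (D : Digraph V) : Prop :=
  ∀ x y : V, x ≠ y → (∃ p, D.IsPath x y p) ∧ (∃ q, D.IsPath y x q)

/-- `D` is `k`-strong: it has at least `k + 1` vertices and stays strong after the deletion of
any set of fewer than `k` vertices. -/
def IsKStrong [Fintype V] (D : Digraph V) (k : ℕ) : Prop :=
  k + 1 ≤ Fintype.card V ∧ ∀ A : Finset V, A.card < k → (D.deleteVertices A).IsStrong

/-- `c` is the cyclic sequence of vertices of a simple directed cycle of `D` (cycles with two
vertices are allowed). The length of the cycle, that is its number of arcs, is `c.length`. -/
structure IsCycle (D : Digraph V) (c : Cycle V) : Prop where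
  nodup : c.Nodup
  two_le_length : 2 ≤ c.length
  chain : c.Chain D.Adj

/-- `D` has a cycle that contains every vertex. -/
def IsHamiltonian (D : Digraph V) : Prop :=
  ∃ c : Cycle V, D.IsCycle c ∧ ∀ v : V, v ∈ c

end Digraph

/-!
Suppose that `D` is not Hamiltonian, and take a longest cycle through `z`. A vertex off this cycle
cannot be inserted between two consecutive vertices of it, so it has at most one arc for each arc of
the cycle. Comparing with the degree condition shows that exactly `b = k + 2` vertices are left out,
and that there is no slack. The vertices are now numbered such that the cycle is `0, 1, …, p` with
`z` at `0`, and no cycle through `0` leaves out fewer than `b` vertices (`LongCycle`).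

As there is no slack, the outer vertices form a complete digraph, none of them is adjacent to `0`,
and there is a threshold `j` such that on the cycle all of them have the out-neighbours `1, …, j`
and the in-neighbours `j, …, p` (`LongCycle.exists_attached`). Hence all vertices lie on the path
`0, 1, …, n - 1`, and from here on a contradiction is usually a cycle through `0` put together from
few intervals of this path (`ExtremalRel.no_long_cycle`).

If `d → 0 → c` with `1 ≤ d < c`, then at least `b` vertices lie between `d` and `c`, for otherwise
the cycle `0, c, …, n - 1, 1, …, d` would be too long. Such a crossing exists
(`Attached.exists_crossing`): if there is none, then at most two pairs `i, i + 1` on the cycle have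
neither `i → 0` nor `0 → i + 1`, because the degree of `0` is large. Deletion of a vertex near `j`
leaves a strong digraph, hence an arc that jumps over this vertex, and with such arcs the cycle can
be extended.

Consider a crossing `d → 0 → c` with the fewest vertices in between. The degree of `0` allows `b`
of them, or three of them if `b = 2`.

* If there are `b`, the cycle `0, c, …, n - 1, 1, …, d` is a longest one, too. The interval that it
  leaves out is therefore attached to it by a threshold, and the two thresholds and 2-strength are
  incompatible (`TightCrossing.contradiction`, `Attached.gap_ne`).
* If `b = 2` and there are three, then `0` has degree exactly `n - 4`. After a reversal of all arcs,
  if necessary, the cycle `0, c, …, n - 1, 1, …, d` is renumbered `0, 1, …, e`. The three vertices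
  off this cycle cannot be inserted into it, because a longest cycle would result: in all places but
  one the first case applies to it, and the last place is excluded by the threshold of the two
  vertices that remain (`ThreeOutside.not_insertable`, `ThreeOutside.not_seg_to_left`). By the
  degree condition, each of the three thus lacks at most one of the admissible arcs, and then the
  deletion of a suitable vertex would separate them from the rest (`ThreeOutside.contradiction`).
-/

/-! ### Relations on an initial segment of the naturals, and cycles put together from intervals -/

open Classical in
/-- The degree of `i` in the restriction of the relation `R` to `{0, …, n - 1}`: the number of
out-neighbours plus the number of in-neighbours. -/
noncomputable def relDegree (n : ℕ) (R : ℕ → ℕ → Prop) (i : ℕ) : ℕ :=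
  ∑ j ∈ Finset.range n, ((if R i j then 1 else 0) + (if R j i then 1 else 0))

/-- No cycle through `0` on the vertices `0, …, n - 1` has more than `n - b` vertices. The cycle is
listed from `0` on. -/
def ShortCycles (n b : ℕ) (R : ℕ → ℕ → Prop) : Prop :=
  ∀ l : List ℕ, (0 :: l).Nodup → (∀ i ∈ l, i < n) → List.IsChain R (0 :: (l ++ [0])) →
    l.length + 1 + b ≤ n

/-- The situation of a hypothetical counterexample, with the vertices numbered `0, …, n - 1` and
the exceptional vertex numbered `0`: a loopless 2-strong digraph `R` on `n` vertices in which every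
vertex but `0` has degree at least `n + b - 2`, the vertex `0` has degree at least `n - b - 2`, and
no cycle through `0` is longer than `n - b`. -/
structure ExtremalRel (n b : ℕ) (R : ℕ → ℕ → Prop) : Prop where
  two_le : 2 ≤ b
  le_card : b + 2 ≤ n
  irrefl : ∀ i, ¬ R i i
  degree : ∀ i, 0 < i → i < n → n + b ≤ relDegree n R i + 2
  degree_zero : n ≤ relDegree n R 0 + b + 2
  /-- After deletion of `v`, every proper nonempty set `U` of vertices is left by an arc. -/
  cut : ∀ v < n, ∀ U : ℕ → Prop, (∃ u < n, u ≠ v ∧ U u) → (∃ w < n, w ≠ v ∧ ¬ U w) →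
    ∃ u w, u < n ∧ w < n ∧ u ≠ v ∧ w ≠ v ∧ U u ∧ ¬ U w ∧ R u w
  short : ShortCycles n b R

namespace ExtremalRel

variable {n b : ℕ} {R : ℕ → ℕ → Prop}

/-- Renumbering the vertices, with `0` kept. -/
theorem comp (h : ExtremalRel n b R) (σ : ℕ → ℕ) (hlt : ∀ i < n, σ i < n)
    (hinj : ∀ i < n, ∀ j < n, σ i = σ j → i = j) (h0 : σ 0 = 0) :
    ExtremalRel n b (fun i j => R (σ i) (σ j)) := by
  classical
  have himg : (Finset.range n).image σ = Finset.range n := by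
    apply Finset.eq_of_subset_of_card_le
    · intro x hx
      simp only [Finset.mem_image, Finset.mem_range] at hx ⊢
      obtain ⟨i, hi, rfl⟩ := hx
      exact hlt i hi
    · rw [Finset.card_image_of_injOn]
      intro i hi j hj hij
      simp only [Finset.coe_range, Set.mem_Iio] at hi hj
      exact hinj i hi j hj hij
  have hsurj : ∀ w < n, ∃ i < n, σ i = w := by
    intro w hw
    have : w ∈ (Finset.range n).image σ := by rw [himg]; simpa using hw
    simpa using this
  have hn : 0 < n := by have := h.le_card; omega
  have hdeg : ∀ i, relDegree n (fun i j => R (σ i) (σ j)) i = relDegree n R (σ i) := by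
    intro i
    unfold relDegree
    conv_rhs => rw [← himg]
    rw [Finset.sum_image]
    intro i hi j hj hij
    simp only [Finset.coe_range, Set.mem_Iio] at hi hj
    exact hinj i hi j hj hij
  refine ⟨h.two_le, h.le_card, fun i => h.irrefl _, ?_, ?_, ?_, ?_⟩
  · intro i h1 h2
    rw [hdeg]
    refine h.degree _ ?_ (hlt i h2)
    rcases Nat.eq_zero_or_pos (σ i) with h3 | h3
    · have := hinj i h2 0 hn (by rw [h3, h0]); omega
    · exact h3
  · rw [hdeg, h0]
    exact h.degree_zero
  · intro v hv U ⟨u, hu, huv, hU⟩ ⟨w, hw, hwv, hW⟩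
    have hU' : ∀ i < n, (∃ k < n, σ k = σ i ∧ U k) ↔ U i := by
      intro i hi
      constructor
      · rintro ⟨k, hk, hki, hUk⟩
        rwa [← hinj k hk i hi hki]
      · exact fun hUi => ⟨i, hi, rfl, hUi⟩
    obtain ⟨u', w', h1, h2, h3, h4, h5, h6, h7⟩ := h.cut (σ v) (hlt v hv)
      (fun x => ∃ k < n, σ k = x ∧ U k)
      ⟨σ u, hlt u hu, fun e => huv (hinj u hu v hv e), u, hu, rfl, hU⟩
      ⟨σ w, hlt w hw, fun e => hwv (hinj w hw v hv e), by rwa [hU' w hw]⟩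
    obtain ⟨i, hi, rfl⟩ := hsurj u' h1
    obtain ⟨j, hj, rfl⟩ := hsurj w' h2
    rw [hU' i hi] at h5
    rw [hU' j hj] at h6
    exact ⟨i, j, hi, hj, fun e => h3 (by rw [e]), fun e => h4 (by rw [e]), h5, h6, h7⟩
  · intro l hl hln hch
    have hln' : ∀ i ∈ 0 :: l, i < n := by simpa [hn] using hln
    have h1 := h.short (l.map σ) ?_ ?_ ?_
    · simpa using h1
    · have : (0 :: l.map σ) = (0 :: l).map σ := by simp [h0]
      rw [this]
      refine List.Nodup.map_on ?_ hl
      intro x hx y hy hxy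
      exact hinj x (hln' x hx) y (hln' y hy) hxy
    · intro i hi
      simp only [List.mem_map] at hi
      obtain ⟨k, hk, rfl⟩ := hi
      exact hlt k (hln k hk)
    · have : (0 :: (l.map σ ++ [0])) = (0 :: (l ++ [0])).map σ := by simp [h0]
      rw [this, List.isChain_map]
      exact hch

/-- Reversing all arcs. -/
theorem swap (h : ExtremalRel n b R) : ExtremalRel n b (fun i j => R j i) := by
  have hdeg : ∀ i, relDegree n (fun i j => R j i) i = relDegree n R i := by
    intro i
    unfold relDegree
    exact Finset.sum_congr rfl fun j _ => by rw [add_comm]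
  refine ⟨h.two_le, h.le_card, h.irrefl, ?_, ?_, ?_, ?_⟩
  · intro i h1 h2
    rw [hdeg]
    exact h.degree i h1 h2
  · rw [hdeg]
    exact h.degree_zero
  · intro v hv U ⟨u, hu, huv, hU⟩ ⟨w, hw, hwv, hW⟩
    obtain ⟨x, y, h1, h2, h3, h4, h5, h6, h7⟩ := h.cut v hv (fun x => ¬ U x) ⟨w, hw, hwv, hW⟩
      ⟨u, hu, huv, by simpa using hU⟩
    exact ⟨y, x, h2, h1, h4, h3, by simpa using h6, h5, h7⟩
  · intro l hl hln hch
    have h1 := h.short l.reverse ?_ ?_ ?_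
    · simpa using h1
    · simpa using hl
    · simpa using hln
    · have : (0 :: (l.reverse ++ [0])) = (0 :: (l ++ [0])).reverse := by simp
      rw [this, List.isChain_reverse]
      exact hch

end ExtremalRel

/-- The vertices `s.1, s.1 + 1, …, s.2`. -/
def interval (s : ℕ × ℕ) : List ℕ := List.range' s.1 (s.2 + 1 - s.1)

theorem mem_interval {s : ℕ × ℕ} {i : ℕ} : i ∈ interval s ↔ s.1 ≤ i ∧ i ≤ s.2 := by
  unfold interval
  rw [List.mem_range'_1]
  omega

theorem getLast?_interval {s : ℕ × ℕ} (hs : s.1 ≤ s.2) : (interval s).getLast? = some s.2 := by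
  unfold interval
  rw [List.getLast?_range', if_neg (by omega)]
  congr 1
  omega

theorem head?_interval {s : ℕ × ℕ} (hs : s.1 ≤ s.2) : (interval s).head? = some s.1 := by
  unfold interval
  rw [List.head?_range', if_neg (by omega)]

theorem isChain_interval {R : ℕ → ℕ → Prop} {s : ℕ × ℕ}
    (hs : ∀ i, s.1 ≤ i → i < s.2 → R i (i + 1)) :
    List.IsChain R (interval s) := by
  rw [List.isChain_iff_getElem]
  intro i hi
  simp only [interval, List.length_range', List.getElem_range'] at hi ⊢
  have := hs (s.1 + 1 * i) (by omega) (by omega)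
  rwa [show s.1 + 1 * (i + 1) = s.1 + 1 * i + 1 by ring]

theorem isChain_congr_mem {α : Type*} {P Q : α → α → Prop} :
    ∀ {l : List α}, (∀ s ∈ l, ∀ t ∈ l, P s t → Q s t) → List.IsChain P l → List.IsChain Q l
  | [], _, _ => List.isChain_nil
  | [a], _, _ => List.isChain_singleton a
  | a :: c :: l, hPQ, hl => by
    rw [List.isChain_cons_cons] at hl ⊢
    exact ⟨hPQ _ (by simp) _ (by simp) hl.1,
      isChain_congr_mem (fun s hs t ht => hPQ s (by simp [hs]) t (by simp [ht])) hl.2⟩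

namespace ShortCycles

variable {n b : ℕ} {R : ℕ → ℕ → Prop}

/-- A cycle through `0` that is put together from lists of vertices misses at least `b`
vertices. -/
theorem flatten_length_le (h : ShortCycles n b R) (l : List ℕ) (L : List (List ℕ))
    (hne : [] ∉ L) (hnodup : ∀ s ∈ (0 :: l) :: L, s.Nodup)
    (hdisj : List.Pairwise List.Disjoint ((0 :: l) :: L))
    (hlt : ∀ s ∈ (0 :: l) :: L, ∀ i ∈ s, i < n)
    (hch : ∀ s ∈ (0 :: l) :: L, List.IsChain R s)
    (hlink : List.IsChain (fun s t => ∀ x ∈ s.getLast?, ∀ y ∈ t.head?, R x y)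
      (((0 :: l) :: L) ++ [[0]])) :
    (((0 :: l) :: L).map List.length).sum + b ≤ n := by
  have e : (((0 :: l) :: L) ++ [[0]]).flatten = 0 :: ((l ++ L.flatten) ++ [0]) := by simp
  have h1 := h (l ++ L.flatten) ?_ ?_ ?_
  · simp only [List.length_append, List.length_flatten] at h1
    simp only [List.map_cons, List.sum_cons, List.length_cons]
    omega
  · have : (0 :: (l ++ L.flatten)) = ((0 :: l) :: L).flatten := by simp
    rw [this, List.nodup_flatten]
    exact ⟨hnodup, hdisj⟩
  · intro i hi
    have : i ∈ ((0 :: l) :: L).flatten := by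
      simp only [List.flatten_cons, List.cons_append, List.mem_cons]
      exact Or.inr hi
    obtain ⟨s, hs, his⟩ := List.mem_flatten.1 this
    exact hlt s hs i his
  · rw [← e, List.isChain_flatten]
    · refine ⟨?_, hlink⟩
      intro s hs
      rcases List.mem_append.1 hs with hs | hs
      · exact hch s hs
      · simp only [List.mem_singleton] at hs
        subst hs
        exact List.isChain_singleton 0
    · simpa using hne

/-- There is no cycle through `0` that is put together from intervals of consecutive vertices and
misses fewer than `b` vertices. The cycle runs through `0, …, e` and then, for the pairs `s` in `L`
in turn, through `s.1, …, s.2`. -/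
theorem no_long_cycle_of_intervals (h : ShortCycles n b R) (e : ℕ) (L : List (ℕ × ℕ))
    (hpath : ∀ s ∈ (0, e) :: L, ∀ i, s.1 ≤ i → i < s.2 → R i (i + 1))
    (hlink : List.IsChain (fun s t => R s.2 t.1) (((0, e) :: L) ++ [(0, 0)]))
    (hle : ∀ s ∈ (0, e) :: L, s.1 ≤ s.2 ∧ s.2 < n)
    (hdisj : List.Pairwise (fun s t => s.2 < t.1 ∨ t.2 < s.1) ((0, e) :: L))
    (hlen : n < (((0, e) :: L).map fun s => s.2 + 1 - s.1).sum + b) : False := by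
  have e0 : interval (0, e) = 0 :: List.range' 1 e := by
    simp [interval, List.range'_succ]
  have hmap : ((0, e) :: L).map interval = (0 :: List.range' 1 e) :: L.map interval := by
    simp [e0]
  have h1 := h.flatten_length_le (List.range' 1 e) (L.map interval) ?_ ?_ ?_ ?_ ?_ ?_
  · rw [← hmap, List.map_map] at h1
    have : (List.length ∘ interval) = fun s : ℕ × ℕ => s.2 + 1 - s.1 := by
      funext s; simp [interval]
    rw [this] at h1
    omega
  · intro hmem
    obtain ⟨s, hs, hs'⟩ := List.mem_map.1 hmem
    have := hle s (by simp [hs])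
    have h2 := head?_interval this.1
    rw [hs'] at h2
    simp at h2
  · rw [← hmap]
    intro s hs
    obtain ⟨s, -, rfl⟩ := List.mem_map.1 hs
    exact List.nodup_range'
  · rw [← hmap, List.pairwise_map]
    refine hdisj.imp ?_
    intro s t hst i hi hi'
    rw [mem_interval] at hi hi'
    omega
  · rw [← hmap]
    intro s hs i hi
    obtain ⟨t, ht, rfl⟩ := List.mem_map.1 hs
    have := hle t ht
    rw [mem_interval] at hi
    omega
  · rw [← hmap]
    intro s hs
    obtain ⟨t, ht, rfl⟩ := List.mem_map.1 hs
    exact isChain_interval (hpath t ht)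
  · have e1 : [[0]] = [((0, 0) : ℕ × ℕ)].map interval := by simp [interval]
    rw [← hmap, e1, ← List.map_append, List.isChain_map]
    have hle' : ∀ s ∈ (0, e) :: L ++ [(0, 0)], s.1 ≤ s.2 := by
      intro s hs
      rcases List.mem_append.1 hs with hs | hs
      · exact (hle s hs).1
      · simp only [List.mem_singleton] at hs
        subst hs
        exact le_refl _
    refine isChain_congr_mem ?_ hlink
    intro s hs t ht hst x hx y hy
    rw [getLast?_interval (hle' s hs)] at hx
    rw [head?_interval (hle' t ht)] at hy
    simp only [Option.mem_some_iff] at hx hy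
    subst hx hy
    exact hst

/-- A vertex `y` off a longest possible cycle `0, 1, …, p` cannot be inserted into it. -/
theorem not_insertable (h : ShortCycles n b R) {p y i : ℕ} (hn : n = p + b + 1)
    (harc : ∀ i < p, R i (i + 1)) (hclose : R p 0) (hpy : p < y) (hyn : y < n) (hi : i < p) :
    ¬ (R i y ∧ R y (i + 1)) := by
  rintro ⟨h1, h2⟩
  refine h.no_long_cycle_of_intervals i [(y, y), (i + 1, p)] ?_
    (.cons_cons h1 (.cons_cons h2 (.cons_cons hclose (.singleton _)))) ?_ ?_ ?_
  · simp only [List.forall_mem_cons]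
    refine ⟨fun k _ hk => harc k (by omega), fun k _ _ => by omega,
      fun k _ hk => harc k hk, by simp⟩
  · simp; omega
  · simp; omega
  · simp; omega

theorem not_insertable_last (h : ShortCycles n b R) {p y : ℕ} (hn : n = p + b + 1)
    (harc : ∀ i < p, R i (i + 1)) (hpy : p < y) (hyn : y < n) : ¬ (R p y ∧ R y 0) := by
  rintro ⟨h1, h2⟩
  refine h.no_long_cycle_of_intervals p [(y, y)] ?_
    (.cons_cons h1 (.cons_cons h2 (.singleton _))) ?_ ?_ ?_
  · simp only [List.forall_mem_cons]
    refine ⟨fun k _ hk => harc k (by omega), fun k _ _ => by omega, by simp⟩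
  · simp; omega
  · simp; omega
  · simp; omega

end ShortCycles

namespace ExtremalRel

variable {n b : ℕ} {R : ℕ → ℕ → Prop}

/-- If the vertices are numbered along a path `0, 1, …, n - 1`, there is no cycle through `0` that
is put together from intervals of the path and misses fewer than `b` vertices. The cycle runs
through `0, …, e` and then, for the pairs `s` in `L` in turn, through `s.1, …, s.2`. -/
theorem no_long_cycle (h : ExtremalRel n b R) (hpath : ∀ i, i + 1 < n → R i (i + 1)) (e : ℕ)
    (L : List (ℕ × ℕ))
    (hlink : List.IsChain (fun s t => R s.2 t.1) (((0, e) :: L) ++ [(0, 0)]))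
    (hle : ∀ s ∈ (0, e) :: L, s.1 ≤ s.2 ∧ s.2 < n)
    (hdisj : List.Pairwise (fun s t => s.2 < t.1 ∨ t.2 < s.1) ((0, e) :: L))
    (hlen : n < (((0, e) :: L).map fun s => s.2 + 1 - s.1).sum + b) : False :=
  h.short.no_long_cycle_of_intervals e L
    (fun s hs i _ hi => hpath i (by have := hle s hs; omega)) hlink hle hdisj hlen

end ExtremalRel

/-! ### Attachment of the vertices off a longest cycle -/

open Classical in
/-- Suppose that `y` cannot be inserted into the cycle `0, 1, …, p`. Then `y` has at most
`p + 1` arcs from and to the cycle, one for each arc of the cycle, and its degree drops by one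
for each arc of the cycle whose place stays empty and each vertex off the cycle that is not
joined to `y` in both directions. -/
theorem relDegree_add_card_le {n p : ℕ} {R : ℕ → ℕ → Prop} {y : ℕ} (hpy : p < y) (hyn : y < n)
    (hloop : ¬ R y y)
    (hins : ∀ i < p, ¬ (R i y ∧ R y (i + 1))) (hins' : ¬ (R p y ∧ R y 0)) (T : Finset ℕ)
    (hT : ∀ j ∈ T, j < n ∧ ((j < p ∧ ¬ R j y ∧ ¬ R y (j + 1)) ∨ (j = p ∧ ¬ R p y ∧ ¬ R y 0) ∨
      (p < j ∧ j ≠ y ∧ ¬ (R y j ∧ R j y)))) :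
    relDegree n R y + T.card + p + 3 ≤ 2 * n := by
  classical
  suffices hfil : relDegree n R y + ((Finset.range n).filter fun j =>
      (j < p ∧ ¬ R j y ∧ ¬ R y (j + 1)) ∨ (j = p ∧ ¬ R p y ∧ ¬ R y 0) ∨
      (p < j ∧ j ≠ y ∧ ¬ (R y j ∧ R j y))).card + p + 3 ≤ 2 * n by
    refine le_trans ?_ hfil
    gcongr
    intro j hj
    exact Finset.mem_filter.2 ⟨Finset.mem_range.2 (hT j hj).1, (hT j hj).2⟩
  obtain ⟨m, rfl⟩ : ∃ m, n = p + 1 + m := ⟨n - (p + 1), by omega⟩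
  unfold relDegree
  rw [Finset.card_filter]
  have key : ∀ f : ℕ → ℕ, ∑ j ∈ Finset.range (p + 1 + m), f j =
      ∑ j ∈ Finset.range p, f j + f p + ∑ j ∈ Finset.range m, f (p + 1 + j) := by
    intro f
    rw [Finset.sum_range_add, Finset.sum_range_succ]
  have key' : ∀ f : ℕ → ℕ, ∑ j ∈ Finset.range (p + 1 + m), f j =
      ∑ j ∈ Finset.range p, f (j + 1) + f 0 + ∑ j ∈ Finset.range m, f (p + 1 + j) := by
    intro f
    rw [Finset.sum_range_add, Finset.sum_range_succ']
  rw [Finset.sum_add_distrib, key' (fun j => if R y j then 1 else 0),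
    key (fun j => if R j y then 1 else 0), key]
  have h1 : ∑ j ∈ Finset.range p, (if R y (j + 1) then 1 else 0) +
      ∑ j ∈ Finset.range p, (if R j y then 1 else 0) +
      ∑ j ∈ Finset.range p, (if (j < p ∧ ¬ R j y ∧ ¬ R y (j + 1)) ∨
        (j = p ∧ ¬ R p y ∧ ¬ R y 0) ∨ (p < j ∧ j ≠ y ∧ ¬ (R y j ∧ R j y)) then 1 else 0)
      ≤ p := by
    rw [← Finset.sum_add_distrib, ← Finset.sum_add_distrib]
    calc _ ≤ ∑ j ∈ Finset.range p, 1 := by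
          refine Finset.sum_le_sum fun j hj => ?_
          have hj := Finset.mem_range.1 hj
          have := hins j hj
          split_ifs <;> first | omega | (exfalso; grind)
      _ = p := by simp
  have h2 : ∑ j ∈ Finset.range m, (if R y (p + 1 + j) then 1 else 0) +
      ∑ j ∈ Finset.range m, (if R (p + 1 + j) y then 1 else 0) +
      ∑ j ∈ Finset.range m, (if (p + 1 + j < p ∧ ¬ R (p + 1 + j) y ∧ ¬ R y (p + 1 + j + 1)) ∨
        (p + 1 + j = p ∧ ¬ R p y ∧ ¬ R y 0) ∨
        (p < p + 1 + j ∧ p + 1 + j ≠ y ∧ ¬ (R y (p + 1 + j) ∧ R (p + 1 + j) y)) then 1 else 0)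
      + 2 ≤ 2 * m := by
    rw [← Finset.sum_add_distrib, ← Finset.sum_add_distrib]
    have h3 : ∑ j ∈ Finset.range m, (if j = y - (p + 1) then 2 else 0) = 2 := by
      rw [Finset.sum_ite_eq', if_pos (Finset.mem_range.2 (by omega))]
    have h4 : ∑ j ∈ Finset.range m, 2 = 2 * m := by simp [mul_comm]
    rw [← h4]
    refine (Nat.add_le_add_left h3.ge _).trans ?_
    rw [← Finset.sum_add_distrib]
    refine Finset.sum_le_sum fun j hj => ?_
    by_cases hjy : p + 1 + j = y
    · rw [if_pos (show j = y - (p + 1) by omega)]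
      rw [hjy]
      split_ifs <;> omega
    · rw [if_neg (show ¬ j = y - (p + 1) by omega)]
      split_ifs <;> first | omega | (exfalso; grind)
  have h5 : ((if R y 0 then 1 else 0) + (if R p y then 1 else 0) +
      (if (p < p ∧ ¬ R p y ∧ ¬ R y (p + 1)) ∨ (p = p ∧ ¬ R p y ∧ ¬ R y 0) ∨
        (p < p ∧ p ≠ y ∧ ¬ (R y p ∧ R p y)) then 1 else 0) : ℕ) ≤ 1 := by
    split_ifs <;> first | omega | (exfalso; grind)
  omega

/-- A longest possible cycle `0, 1, …, p` through `0` in the situation of `ExtremalRel`. -/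
structure LongCycle (n b p : ℕ) (R : ℕ → ℕ → Prop) : Prop extends ExtremalRel n b R where
  card_eq : n = p + b + 1
  arc : ∀ i < p, R i (i + 1)
  close : R p 0

/-- How the vertices `p + 1, …, n - 1` are attached to the cycle `0, 1, …, p`: they form a complete
digraph, none of them is adjacent to `0`, and each has the out-neighbours `1, …, j` and the
in-neighbours `j, …, p` on the cycle. -/
structure Attached (n b p j : ℕ) (R : ℕ → ℕ → Prop) : Prop extends LongCycle n b p R where
  one_le : 1 ≤ j
  le_length : j ≤ p
  complete : ∀ y y', p < y → y < n → p < y' → y' < n → y ≠ y' → R y y'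
  not_from_zero : ∀ y, p < y → y < n → ¬ R 0 y
  not_to_zero : ∀ y, p < y → y < n → ¬ R y 0
  out_iff : ∀ y i, p < y → y < n → 1 ≤ i → i ≤ p → (R y i ↔ i ≤ j)
  in_iff : ∀ y i, p < y → y < n → 1 ≤ i → i ≤ p → (R i y ↔ j ≤ i)

namespace LongCycle

variable {n b p : ℕ} {R : ℕ → ℕ → Prop}

theorem not_insertable (h : LongCycle n b p R) {y : ℕ} (hpy : p < y) (hyn : y < n) {i : ℕ}
    (hi : i < p) : ¬ (R i y ∧ R y (i + 1)) :=
  h.short.not_insertable h.card_eq h.arc h.close hpy hyn hi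

theorem not_insertable_last (h : LongCycle n b p R) {y : ℕ} (hpy : p < y) (hyn : y < n) :
    ¬ (R p y ∧ R y 0) :=
  h.short.not_insertable_last h.card_eq h.arc hpy hyn

/-- The degree condition leaves no slack for a vertex `y` off the cycle. -/
theorem no_defect (h : LongCycle n b p R) {y : ℕ} (hpy : p < y) (hyn : y < n) {j : ℕ} (hj : j < n) :
    ¬ ((j < p ∧ ¬ R j y ∧ ¬ R y (j + 1)) ∨ (j = p ∧ ¬ R p y ∧ ¬ R y 0) ∨
      (p < j ∧ j ≠ y ∧ ¬ (R y j ∧ R j y))) := by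
  classical
  intro hd
  have h1 := relDegree_add_card_le hpy hyn (h.irrefl y) (fun i hi => h.not_insertable hpy hyn hi)
    (h.not_insertable_last hpy hyn) {j} (by
      intro k hk
      rw [Finset.mem_singleton] at hk
      subst hk
      exact ⟨hj, hd⟩)
  have h2 := h.degree y (by omega) hyn
  have hc := h.card_eq
  rw [Finset.card_singleton] at h1
  omega

theorem complete (h : LongCycle n b p R) {y y' : ℕ} (hpy : p < y) (hyn : y < n) (hpy' : p < y')
    (hyn' : y' < n) (hne : y ≠ y') : R y y' := by
  have := h.no_defect hpy hyn hyn'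
  grind

/-- The vertices off the cycle have the same neighbours on the cycle. -/
theorem arc_iff (h : LongCycle n b p R) {y y' : ℕ} (hpy : p < y) (hyn : y < n) (hpy' : p < y')
    (hyn' : y' < n) {i : ℕ} (hi : i < p) : R i y ↔ ¬ R y' (i + 1) := by
  have hb := h.two_le
  have hc := h.card_eq
  constructor
  · intro h1 h2
    rcases eq_or_ne y y' with rfl | hne
    · exact h.not_insertable hpy hyn hi ⟨h1, h2⟩
    refine h.short.no_long_cycle_of_intervals i [(y, y), (y', y'), (i + 1, p)] ?_
      (.cons_cons h1 (.cons_cons (h.complete hpy hyn hpy' hyn' hne)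
        (.cons_cons h2 (.cons_cons h.close (.singleton _))))) ?_ ?_ ?_
    · simp only [List.forall_mem_cons]
      refine ⟨fun k _ hk => h.arc k (by omega), fun k _ _ => by omega, fun k _ _ => by omega,
        fun k _ hk => h.arc k hk, by simp⟩
    · simp; omega
    · simp; omega
    · simp; omega
  · intro h2
    by_contra h1
    rcases eq_or_ne y y' with rfl | hne
    · have := h.no_defect hpy hyn (j := i) (by omega)
      grind
    have h3 := h.no_defect hpy hyn (j := i) (by omega)
    have h4 := h.no_defect hpy' hyn' (j := i) (by omega)
    have h5 : R y (i + 1) := by grind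
    have h6 : R i y' := by grind
    refine h.short.no_long_cycle_of_intervals i [(y', y'), (y, y), (i + 1, p)] ?_
      (.cons_cons h6 (.cons_cons (h.complete hpy' hyn' hpy hyn hne.symm)
        (.cons_cons h5 (.cons_cons h.close (.singleton _))))) ?_ ?_ ?_
    · simp only [List.forall_mem_cons]
      refine ⟨fun k _ hk => h.arc k (by omega), fun k _ _ => by omega, fun k _ _ => by omega,
        fun k _ hk => h.arc k hk, by simp⟩
    · simp; omega
    · simp; omega
    · simp; omega

theorem arc_last_iff (h : LongCycle n b p R) {y y' : ℕ} (hpy : p < y) (hyn : y < n) (hpy' : p < y')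
    (hyn' : y' < n) : R p y ↔ ¬ R y' 0 := by
  have hb := h.two_le
  have hc := h.card_eq
  have main : ∀ u v, p < u → u < n → p < v → v < n → ¬ (R p u ∧ R v 0) := by
    rintro u v hpu hun hpv hvn ⟨h1, h2⟩
    rcases eq_or_ne u v with rfl | hne
    · exact h.not_insertable_last hpu hun ⟨h1, h2⟩
    refine h.short.no_long_cycle_of_intervals p [(u, u), (v, v)] ?_
      (.cons_cons h1 (.cons_cons (h.complete hpu hun hpv hvn hne)
        (.cons_cons h2 (.singleton _)))) ?_ ?_ ?_
    · simp only [List.forall_mem_cons]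
      refine ⟨fun k _ hk => h.arc k (by omega), fun k _ _ => by omega, fun k _ _ => by omega,
        by simp⟩
    · simp; omega
    · simp; omega
    · simp; omega
  have h3 := h.no_defect hpy hyn (j := p) (by omega)
  have h4 := h.no_defect hpy' hyn' (j := p) (by omega)
  have h5 := main y y' hpy hyn hpy' hyn'
  have h6 := main y' y hpy' hyn' hpy hyn
  grind

/-- A vertex of the cycle other than `0` cannot be replaced by two vertices off the cycle. This is
why the in-neighbours of the outer vertices form a final segment of the cycle. -/
theorem arc_succ (h : LongCycle n b p R) {y : ℕ} (hpy : p < y) (hyn : y < n) {i : ℕ} (hi : i < p)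
    (hiy : R i y) : R (i + 1) y := by
  have hb := h.two_le
  have hc := h.card_eq
  by_contra hcon
  obtain ⟨y', hpy', hyn', hne⟩ : ∃ y', p < y' ∧ y' < n ∧ y ≠ y' := by
    by_cases hy : y = p + 1
    · exact ⟨p + 2, by omega, by omega, by omega⟩
    · exact ⟨p + 1, by omega, by omega, hy⟩
  have hyy := h.complete hpy hyn hpy' hyn' hne
  rcases Nat.lt_or_ge (i + 1) p with h1 | h1
  · have h2 : R y' (i + 1 + 1) := by
      by_contra h2
      exact hcon ((h.arc_iff hpy hyn hpy' hyn' h1).2 h2)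
    refine h.short.no_long_cycle_of_intervals i [(y, y), (y', y'), (i + 2, p)] ?_
      (.cons_cons hiy (.cons_cons hyy (.cons_cons h2 (.cons_cons h.close (.singleton _))))) ?_ ?_ ?_
    · simp only [List.forall_mem_cons]
      refine ⟨fun k _ hk => h.arc k (by omega), fun k _ _ => by omega, fun k _ _ => by omega,
        fun k _ hk => h.arc k hk, by simp⟩
    · simp; omega
    · simp; omega
    · simp; omega
  · obtain rfl : p = i + 1 := by omega
    have h2 : R y' 0 := by
      by_contra h2
      exact hcon ((h.arc_last_iff hpy hyn hpy' hyn').2 h2)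
    refine h.short.no_long_cycle_of_intervals i [(y, y), (y', y')] ?_
      (.cons_cons hiy (.cons_cons hyy (.cons_cons h2 (.singleton _)))) ?_ ?_ ?_
    · simp only [List.forall_mem_cons]
      refine ⟨fun k _ hk => h.arc k (by omega), fun k _ _ => by omega, fun k _ _ => by omega,
        by simp⟩
    · simp; omega
    · simp; omega
    · simp; omega

/-- The attachment of the vertices off a longest possible cycle. -/
theorem exists_attached (h : LongCycle n b p R) : ∃ j, Attached n b p j R := by
  classical
  have hb := h.two_le
  have hc := h.card_eq
  have hp : 1 ≤ p := by have := h.le_card; omega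
  have hmono : ∀ y, p < y → y < n → ∀ i k, i ≤ k → k ≤ p → R i y → R k y := by
    intro y hpy hyn i k hik
    induction k, hik using Nat.le_induction with
    | base => exact fun _ h1 => h1
    | succ k hik ih => exact fun h1 h2 => h.arc_succ hpy hyn (by omega) (ih (by omega) h2)
  -- by strength, some vertex of the cycle is joined to an outer vertex, and hence `p` is
  have hlast : ∀ y, p < y → y < n → R p y := by
    obtain ⟨u, w, h1, h2, h3, h4, h5, h6, h7⟩ := h.cut 0 (by omega) (fun i => i ≤ p)
      ⟨p, by omega, by omega, le_refl _⟩ ⟨p + 1, by omega, by omega, by omega⟩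
    have hw : R p w := hmono w (by omega) h2 u p h5 (le_refl _) h7
    intro y hpy hyn
    rw [h.arc_last_iff hpy hyn (show p < w by omega) h2]
    exact (h.arc_last_iff (by omega) h2 (by omega) h2).1 hw
  have hto : ∀ y, p < y → y < n → ¬ R y 0 := fun y hpy hyn =>
    (h.arc_last_iff hpy hyn hpy hyn).1 (hlast y hpy hyn)
  have hfrom : ∀ y, p < y → y < n → ¬ R 0 y := by
    intro y hpy hyn h0
    obtain ⟨u, w, h1, h2, h3, h4, h5, h6, h7⟩ := h.cut 0 (by omega) (fun i => p < i)
      ⟨p + 1, by omega, by omega, by omega⟩ ⟨p, by omega, by omega, by omega⟩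
    obtain ⟨i, rfl⟩ : ∃ i, w = i + 1 := ⟨w - 1, by omega⟩
    exact (h.arc_iff hpy hyn h5 h1 (by omega)).1
      (hmono y hpy hyn 0 i (by omega) (by omega) h0) h7
  have hex : ∃ j, R j (p + 1) := ⟨p, hlast _ (by omega) (by omega)⟩
  have hj1 : 1 ≤ Nat.find hex := by
    rcases Nat.eq_zero_or_pos (Nat.find hex) with h0 | h0
    · have := Nat.find_spec hex
      rw [h0] at this
      exact absurd this (hfrom _ (by omega) (by omega))
    · exact h0
  have hjp : Nat.find hex ≤ p := Nat.find_min' hex (hlast _ (by omega) (by omega))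
  have hin : ∀ y i, p < y → y < n → i < p → (R i y ↔ Nat.find hex ≤ i) := by
    intro y i hpy hyn hip
    rw [h.arc_iff hpy hyn (show p < p + 1 by omega) (by omega) hip,
      ← h.arc_iff (show p < p + 1 by omega) (by omega) (show p < p + 1 by omega) (by omega) hip]
    constructor
    · exact fun h1 => Nat.find_min' hex h1
    · exact fun h1 => hmono _ (by omega) (by omega) _ i h1 (by omega) (Nat.find_spec hex)
  refine ⟨Nat.find hex, h, hj1, hjp, fun y y' h1 h2 h3 h4 h5 => h.complete h1 h2 h3 h4 h5,
    hfrom, hto, ?_, ?_⟩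
  · intro y i hpy hyn h1 h2
    obtain ⟨k, rfl⟩ : ∃ k, i = k + 1 := ⟨i - 1, by omega⟩
    have h3 := h.arc_iff hpy hyn hpy hyn (show k < p by omega)
    have h4 := hin y k hpy hyn (by omega)
    constructor
    · intro h5
      by_contra h6
      exact h3.1 (h4.2 (by omega)) h5
    · intro h5
      by_contra h6
      have := h4.1 (h3.2 h6)
      omega
  · intro y i hpy hyn h1 h2
    rcases Nat.lt_or_ge i p with h3 | h3
    · exact hin y i hpy hyn h3
    · obtain rfl : i = p := by omega
      exact ⟨fun _ => hjp, fun _ => hlast y hpy hyn⟩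

end LongCycle

namespace Attached

variable {n b p j : ℕ} {R : ℕ → ℕ → Prop}

/-- The vertices are numbered along a path. -/
theorem path (h : Attached n b p j R) (i : ℕ) (hi : i + 1 < n) : R i (i + 1) := by
  have hc := h.card_eq
  have hj := h.one_le
  have hjp := h.le_length
  rcases Nat.lt_trichotomy i p with h1 | rfl | h1
  · exact h.arc i h1
  · exact (h.in_iff _ _ (by omega) hi (by omega) (le_refl _)).2 hjp
  · exact h.complete i (i + 1) h1 (by omega) (by omega) hi (by omega)

end Attached

/-! ### Jumping arcs, and the existence of a crossing `d → 0 → c` -/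

namespace Attached

variable {n b p j : ℕ} {R : ℕ → ℕ → Prop}

theorem to_one (h : Attached n b p j R) {y i : ℕ} (hpy : p < y) (hyn : y < n) (hi : 1 ≤ i)
    (hij : i ≤ j) : R y i :=
  (h.out_iff y i hpy hyn hi (hij.trans h.le_length)).2 hij

theorem to_outer (h : Attached n b p j R) {y i : ℕ} (hpy : p < y) (hyn : y < n) (hij : j ≤ i)
    (hip : i ≤ p) : R i y :=
  (h.in_iff y i hpy hyn (h.one_le.trans hij) hip).2 hij

/-- If `d → 0 → c` with `d < c`, then at least `b` vertices lie between `d` and `c`. -/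
theorem gap_le (h : Attached n b p j R) {d c : ℕ} (hd : 1 ≤ d) (hdc : d < c) (hc : c ≤ p)
    (hd0 : R d 0) (h0c : R 0 c) : d + b + 1 ≤ c := by
  have hb := h.two_le
  have hn := h.card_eq
  by_contra hcon
  refine h.no_long_cycle h.path 0 [(c, n - 1), (1, d)] (.cons_cons h0c (.cons_cons
    (h.to_one (by omega) (by omega) le_rfl h.one_le) (.cons_cons hd0 (.singleton _)))) ?_ ?_ ?_
  · simp; omega
  · simp; omega
  · simp; omega

open Classical in
/-- The vertex `0` has at most one arc for each pair of consecutive vertices `i`, `i + 1` of the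
cycle, and loses one for each pair with neither `i → 0` nor `0 → i + 1`. -/
theorem relDegree_zero_add_card_le (h : Attached n b p j R) (T : Finset ℕ)
    (hT : ∀ i ∈ T, i ≤ p ∧ ¬ R i 0 ∧ ¬ R 0 (i + 1)) : relDegree n R 0 + T.card ≤ p + 1 := by
  have hb := h.two_le
  have hn := h.card_eq
  obtain ⟨m, rfl⟩ : ∃ m, n = m + 1 := ⟨n - 1, by omega⟩
  have h1 : relDegree (m + 1) R 0 = ∑ i ∈ Finset.range m,
      ((if R i 0 then 1 else 0) + (if R 0 (i + 1) then 1 else 0)) := by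
    unfold relDegree
    rw [Finset.sum_add_distrib, Finset.sum_range_succ' (fun i => if R 0 i then 1 else 0),
      Finset.sum_range_succ (fun i => if R i 0 then 1 else 0), if_neg (h.irrefl 0),
      if_neg (h.not_to_zero m (by omega) (by omega)), Finset.sum_add_distrib]
    ring
  have h2 : T.card ≤ ∑ i ∈ Finset.range m, (if i ∈ T then 1 else 0) := by
    rw [← Finset.card_filter]
    refine Finset.card_le_card fun i hi => ?_
    simp only [Finset.mem_filter, Finset.mem_range]
    exact ⟨by have := (hT i hi).1; omega, hi⟩
  have h3 : ∑ i ∈ Finset.range m, (if i < p + 1 then 1 else 0) = p + 1 := by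
    rw [← Finset.card_filter]
    have : (Finset.range m).filter (fun i => i < p + 1) = Finset.range (p + 1) := by
      ext i
      simp only [Finset.mem_filter, Finset.mem_range]
      omega
    rw [this, Finset.card_range]
  rw [h1, ← h3]
  refine (Nat.add_le_add_left h2 _).trans ?_
  rw [← Finset.sum_add_distrib]
  refine Finset.sum_le_sum fun i hi => ?_
  have him := Finset.mem_range.1 hi
  have h4 := hT i
  rcases Nat.lt_or_ge i (p + 1) with h5 | h5
  · have h6 : ¬ (R i 0 ∧ R 0 (i + 1)) := by
      rintro ⟨h7, h8⟩
      rcases Nat.eq_zero_or_pos i with rfl | h9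
      · exact h.irrefl 0 h7
      rcases Nat.lt_or_ge i p with h10 | h10
      · have := h.gap_le h9 (Nat.lt_succ_self i) h10 h7 h8
        omega
      · exact h.not_from_zero (i + 1) (by omega) (by omega) h8
    rw [if_pos h5]
    split_ifs <;> first | omega | (exfalso; grind)
  · have h6 := h.not_to_zero i (by omega) (by omega)
    have h7 := h.not_from_zero (i + 1) (by omega) (by omega)
    have h8 : i ∉ T := fun h8 => by have := (h4 h8).1; omega
    rw [if_neg h6, if_neg h7, if_neg h8]
    omega

/-- At most two pairs of consecutive vertices are missed by `0`. -/
theorem card_le_two (h : Attached n b p j R) (T : Finset ℕ)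
    (hT : ∀ i ∈ T, i ≤ p ∧ ¬ R i 0 ∧ ¬ R 0 (i + 1)) : T.card ≤ 2 := by
  have h1 := h.relDegree_zero_add_card_le T hT
  have h2 := h.degree_zero
  have h3 := h.card_eq
  omega

theorem pair_of_ne (h : Attached n b p j R) {a c i : ℕ} (hac : a ≠ c) (hia : i ≠ a) (hic : i ≠ c)
    (ha : a ≤ p ∧ ¬ R a 0 ∧ ¬ R 0 (a + 1)) (hc : c ≤ p ∧ ¬ R c 0 ∧ ¬ R 0 (c + 1)) (hi : i ≤ p) :
    R i 0 ∨ R 0 (i + 1) := by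
  by_contra hcon
  have h1 := h.card_le_two {a, c, i} (by
    intro k hk
    simp only [Finset.mem_insert, Finset.mem_singleton] at hk
    rcases hk with rfl | rfl | rfl
    · exact ha
    · exact hc
    · exact ⟨hi, by tauto⟩)
  rw [Finset.card_eq_three.2 ⟨a, c, i, hac, hia.symm, hic.symm, rfl⟩] at h1
  omega

/-- An arc that jumps forward from `a < j` to `e` cuts out an interval of the cycle; the interval
is reached from the outer vertices, so none of its last `b` vertices may have an arc to `0`. -/
theorem not_jump_to_zero (h : Attached n b p j R) {a v e : ℕ} (ha : 1 ≤ a) (haj : a < j)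
    (hav : a < v) (hve : v < e) (he : e ≤ p) (hvb : e ≤ v + b) (hae : R a e) : ¬ R v 0 := by
  intro hv
  have hb := h.two_le
  have hn := h.card_eq
  refine h.no_long_cycle h.path a [(e, n - 1), (a + 1, v)] (.cons_cons hae (.cons_cons
    (h.to_one (by omega) (by omega) (by omega) haj) (.cons_cons hv (.singleton _)))) ?_ ?_ ?_
  · simp; omega
  · simp; omega
  · simp; omega

/-- The interval cut out by an arc that jumps forward from `a` to `e > j` has an arc to the outer
vertices, so its first vertex is not an out-neighbour of `0`. -/
theorem not_jump_from_zero (h : Attached n b p j R) {a e : ℕ} (ha : 1 ≤ a) (hae' : a + 2 ≤ e)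
    (hje : j < e) (he : e ≤ p) (hae : R a e) : ¬ R 0 (a + 1) := by
  intro hv
  have hb := h.two_le
  have hn := h.card_eq
  refine h.no_long_cycle h.path 0 [(a + 1, e - 1), (p + 1, n - 1), (1, a), (e, p)]
    (.cons_cons hv (.cons_cons (h.to_outer (by omega) (by omega) (by omega) (by omega))
    (.cons_cons (h.to_one (by omega) (by omega) le_rfl h.one_le) (.cons_cons hae
    (.cons_cons h.close (.singleton _)))))) ?_ ?_ ?_
  · simp; omega
  · simp; omega
  · simp; omega

/-- Reversal of all arcs. The cycle is renumbered accordingly, and the outer vertices keep their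
numbers. -/
theorem reverse (h : Attached n b p j R) : Attached n b p (p + 1 - j) (fun i k =>
    R (if k = 0 ∨ p < k then k else p + 1 - k) (if i = 0 ∨ p < i then i else p + 1 - i)) := by
  have hb := h.two_le
  have hn := h.card_eq
  have hj := h.one_le
  have hjp := h.le_length
  have h1 := (h.comp (fun i => if i = 0 ∨ p < i then i else p + 1 - i) (by grind) (by grind)
    (by grind)).swap
  refine ⟨⟨h1, hn, ?_, ?_⟩, by omega, by omega, ?_, ?_, ?_, ?_, ?_⟩
  · intro i hi
    rw [if_neg (by omega)]
    rcases Nat.eq_zero_or_pos i with rfl | h0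
    · rw [if_pos (Or.inl rfl)]
      exact h.close
    · rw [if_neg (by omega)]
      have := h.arc (p + 1 - (i + 1)) (by omega)
      rwa [show p + 1 - (i + 1) + 1 = p + 1 - i by omega] at this
  · rw [if_pos (Or.inl rfl), if_neg (by omega)]
    have := h.arc 0 (by omega)
    rwa [show p + 1 - p = 0 + 1 by omega]
  · intro y y' h1 h2 h3 h4 h5
    rw [if_pos (Or.inr h1), if_pos (Or.inr h3)]
    exact h.complete y' y h3 h4 h1 h2 h5.symm
  · intro y h1 h2
    rw [if_pos (Or.inr h1), if_pos (Or.inl rfl)]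
    exact h.not_to_zero y h1 h2
  · intro y h1 h2
    rw [if_pos (Or.inr h1), if_pos (Or.inl rfl)]
    exact h.not_from_zero y h1 h2
  · intro y i h1 h2 h3 h4
    rw [if_pos (Or.inr h1), if_neg (by omega), h.in_iff y _ h1 h2 (by omega) (by omega)]
    omega
  · intro y i h1 h2 h3 h4
    rw [if_pos (Or.inr h1), if_neg (by omega), h.out_iff y _ h1 h2 (by omega) (by omega)]
    omega

/-- The case that `0` has no out-neighbour on the cycle after an in-neighbour, and its first
in-neighbour `t` comes no later than `j`. -/
theorem false_of_uncrossed_of_le (h : Attached n b p j R)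
    (hunc : ∀ d c, 1 ≤ d → d < c → c ≤ p → R d 0 → ¬ R 0 c) {t : ℕ} (ht : 1 ≤ t) (htj : t ≤ j)
    (ht0 : R t 0) (hmin : ∀ i, i < t → ¬ R i 0) : False := by
  have hb := h.two_le
  have hn := h.card_eq
  have hjp := h.le_length
  -- the arcs leaving `{0, …, v - 1}` other than to `v` jump over `v`
  have main : ∀ v, t ≤ v → v ≤ j → ∃ a e, 1 ≤ a ∧ a < v ∧ v < e ∧ e ≤ p ∧ R a e := by
    intro v htv hvj
    obtain ⟨u, w, h1, h2, h3, h4, h5, h6, h7⟩ := h.cut v (by omega) (fun i => i < v)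
      ⟨0, by omega, by omega, by omega⟩ ⟨p + 1, by omega, by omega, by omega⟩
    have hwp : w ≤ p := by
      by_contra hwp
      rcases Nat.eq_zero_or_pos u with rfl | h0
      · exact h.not_from_zero w (by omega) h2 h7
      · have := (h.in_iff w u (by omega) h2 h0 (by omega)).1 h7
        omega
    refine ⟨u, w, ?_, h5, by omega, hwp, h7⟩
    rcases Nat.eq_zero_or_pos u with rfl | h0
    · exact absurd h7 (hunc t w ht (by omega) hwp ht0)
    · exact h0
  have hlate : ∀ i, t ≤ i → i < p → ¬ R 0 (i + 1) := fun i h1 h2 =>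
    hunc t (i + 1) ht (by omega) (by omega) ht0
  -- two consecutive non-in-neighbours of `0` after `t` use up the slack in the degree of `0`
  by_cases hgap : ∃ i, t < i ∧ i + 1 ≤ p ∧ ¬ R i 0 ∧ ¬ R (i + 1) 0
  · obtain ⟨i, hti, hip, hi, hi'⟩ := hgap
    have hip' : i + 1 < p := by
      rcases Nat.lt_or_ge (i + 1) p with h1 | h1
      · exact h1
      · exact absurd (by rw [show i + 1 = p by omega]; exact h.close) hi'
    have hpair : ∀ k, k ≤ p → k ≠ i → k ≠ i + 1 → R k 0 ∨ R 0 (k + 1) := fun k hk h1 h2 =>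
      h.pair_of_ne (a := i) (c := i + 1) (by omega) h1 h2
        ⟨by omega, hi, hlate i (by omega) (by omega)⟩
        ⟨by omega, hi', hlate (i + 1) (by omega) (by omega)⟩ hk
    have hlater : ∀ k, t ≤ k → k ≤ p → k ≠ i → k ≠ i + 1 → R k 0 := by
      intro k h1 h2 h3 h4
      rcases Nat.lt_or_ge k p with h5 | h5
      · exact (hpair k h2 h3 h4).resolve_right (hlate k h1 h5)
      · obtain rfl : k = p := by omega
        exact h.close
    by_cases hij : i + 2 ≤ j
    · obtain ⟨a, e, h1, h2, h3, h4, h5⟩ := main (i + 2) (by omega) hij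
      exact h.not_jump_to_zero (v := e - 1) h1 (by omega) (by omega) (by omega) h4 (by omega) h5
        (hlater (e - 1) (by omega) (by omega) (by omega) (by omega))
    · obtain ⟨a, e, h1, h2, h3, h4, h5⟩ := main t le_rfl htj
      by_cases he : e = i + 2
      · exact h.not_jump_from_zero h1 (by omega) (by omega) h4 h5
          ((hpair a (by omega) (by omega) (by omega)).resolve_left (hmin a h2))
      · by_cases he' : e = i + 1
        · exact h.not_jump_to_zero (v := e - 2) h1 (by omega) (by omega) (by omega) h4 (by omega)
            h5 (hlater (e - 2) (by omega) (by omega) (by omega) (by omega))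
        · exact h.not_jump_to_zero (v := e - 1) h1 (by omega) (by omega) (by omega) h4 (by omega)
            h5 (hlater (e - 1) (by omega) (by omega) (by omega) (by omega))
  · obtain ⟨a, e, h1, h2, h3, h4, h5⟩ := main t le_rfl htj
    have h6 := h.not_jump_to_zero (v := e - 1) h1 (by omega) (by omega) (by omega) h4 (by omega) h5
    have h7 : e - 2 ≠ t := fun h7 => h.not_jump_to_zero (v := e - 2) h1 (by omega) (by omega)
      (by omega) h4 (by omega) h5 (by rw [h7]; exact ht0)
    have h8 : e - 1 ≠ t := fun h8 => h6 (by rw [h8]; exact ht0)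
    have h9 := h.not_jump_to_zero (v := e - 2) h1 (by omega) (by omega) (by omega) h4 (by omega) h5
    exact hgap ⟨e - 2, by omega, by omega, h9, by rwa [show e - 2 + 1 = e - 1 by omega]⟩

/-- The case that the out-neighbours of `0` on the cycle come before `j` and its in-neighbours
after `j`. -/
theorem false_of_separated (h : Attached n b p j R) (hout : ∀ i, j ≤ i → i < n → ¬ R 0 i)
    (hin : ∀ i, i ≤ j → ¬ R i 0) : False := by
  have hb := h.two_le
  have hn := h.card_eq
  have hjp := h.le_length
  have hj1 := h.one_le
  have hj2 : 2 ≤ j := by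
    by_contra hcon
    exact hout 1 (by omega) (by omega) (h.arc 0 (by omega))
  have hj3 : j < p := by
    by_contra hcon
    exact hin p (by omega) h.close
  have hpair : ∀ k, k ≤ p → k ≠ j - 1 → k ≠ j → R k 0 ∨ R 0 (k + 1) := fun k hk h1 h2 =>
    h.pair_of_ne (a := j - 1) (c := j) (by omega) h1 h2
      ⟨by omega, hin _ (by omega), hout _ (by omega) (by omega)⟩
      ⟨by omega, hin _ le_rfl, hout _ (by omega) (by omega)⟩ hk
  have hto : ∀ k, j < k → k ≤ p → R k 0 := fun k h1 h2 =>
    (hpair k h2 (by omega) (by omega)).resolve_right (hout _ (by omega) (by omega))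
  have hfrom : ∀ k, 1 ≤ k → k < j → R 0 k := by
    intro k h1 h2
    have := (hpair (k - 1) (by omega) (by omega) (by omega)).resolve_left (hin _ (by omega))
    rwa [show k - 1 + 1 = k by omega] at this
  have hjump : ∀ a e, 1 ≤ a → a < j → j < e → e ≤ p → R a e → a = j - 1 ∧ e = j + 1 := by
    intro a e h1 h2 h3 h4 h5
    constructor
    · by_contra hcon
      exact h.not_jump_from_zero h1 (by omega) h3 h4 h5 (hfrom _ (by omega) (by omega))
    · by_contra hcon
      exact h.not_jump_to_zero (v := e - 1) h1 h2 (by omega) (by omega) h4 (by omega) h5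
        (hto _ (by omega) (by omega))
  have houter : ∀ u w, 1 ≤ u → u < j → p < w → w < n → ¬ R u w := by
    intro u w h1 h2 h3 h4 h5
    have := (h.in_iff w u h3 h4 h1 (by omega)).1 h5
    omega
  -- deletion of `j`, of `j - 1` and of `j + 1` each forces an arc
  have hA : R (j - 1) (j + 1) := by
    obtain ⟨u, w, h1, h2, h3, h4, h5, h6, h7⟩ := h.cut j (by omega) (fun i => i < j)
      ⟨0, by omega, by omega, by omega⟩ ⟨p + 1, by omega, by omega, by omega⟩
    rcases Nat.eq_zero_or_pos u with rfl | h0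
    · exact absurd h7 (hout w (by omega) h2)
    · have hwp : w ≤ p := by
        by_contra hwp
        exact houter u w h0 h5 (by omega) h2 h7
      obtain ⟨rfl, rfl⟩ := hjump u w h0 h5 (by omega) hwp h7
      exact h7
  obtain ⟨a, ha1, ha2, ha⟩ : ∃ a, 1 ≤ a ∧ a < j - 1 ∧ R a j := by
    obtain ⟨u, w, h1, h2, h3, h4, h5, h6, h7⟩ := h.cut (j - 1) (by omega) (fun i => i < j - 1)
      ⟨0, by omega, by omega, by omega⟩ ⟨p + 1, by omega, by omega, by omega⟩
    rcases Nat.eq_zero_or_pos u with rfl | h0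
    · exact absurd h7 (hout w (by omega) h2)
    · have hwp : w ≤ p := by
        by_contra hwp
        exact houter u w h0 (by omega) (by omega) h2 h7
      refine ⟨u, h0, h5, ?_⟩
      have : w = j := by
        by_contra hwj
        have := hjump u w h0 (by omega) (by omega) hwp h7
        omega
      rwa [← this]
  obtain ⟨e, he1, he2, he⟩ : ∃ e, j + 1 < e ∧ e ≤ p ∧ R j e := by
    obtain ⟨u, w, h1, h2, h3, h4, h5, h6, h7⟩ := h.cut (j + 1) (by omega)
      (fun i => 1 ≤ i ∧ i ≤ j ∨ p < i)
      ⟨1, by omega, by omega, by omega⟩ ⟨0, by omega, by omega, by omega⟩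
    have hw : w ≠ 0 := by
      rintro rfl
      rcases h5 with h5 | h5
      · exact hin u h5.2 h7
      · exact h.not_to_zero u h5 h1 h7
    refine ⟨w, by omega, by omega, ?_⟩
    rcases h5 with h5 | h5
    · have : u = j := by
        by_contra huj
        have := hjump u w h5.1 (by omega) (by omega) (by omega) h7
        omega
      rwa [← this]
    · have := (h.out_iff u w h5 h1 (by omega) (by omega)).1 h7
      omega
  refine h.no_long_cycle h.path a [(j, j), (e, n - 1), (a + 1, j - 1), (j + 1, e - 1)]
    (.cons_cons ha (.cons_cons he (.cons_cons (h.to_one (by omega) (by omega) (by omega) (by omega))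
    (.cons_cons hA (.cons_cons (hto _ (by omega) (by omega)) (.singleton _)))))) ?_ ?_ ?_
  · simp; omega
  · simp; omega
  · simp; omega

/-- The vertex `0` has an out-neighbour on the cycle after an in-neighbour. -/
theorem exists_crossing (h : Attached n b p j R) :
    ∃ d c, 1 ≤ d ∧ d < c ∧ c ≤ p ∧ R d 0 ∧ R 0 c := by
  classical
  have hb := h.two_le
  have hn := h.card_eq
  have hjp := h.le_length
  have hj1 := h.one_le
  by_contra hcon
  have hunc : ∀ d c, 1 ≤ d → d < c → c ≤ p → R d 0 → ¬ R 0 c :=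
    fun d c h1 h2 h3 h4 h5 => hcon ⟨d, c, h1, h2, h3, h4, h5⟩
  by_cases hin : ∃ i, 1 ≤ i ∧ i ≤ j ∧ R i 0
  · obtain ⟨h1, h2, h3⟩ := Nat.find_spec hin
    refine h.false_of_uncrossed_of_le hunc h1 h2 h3 fun i hi h4 => ?_
    refine Nat.find_min hin hi ⟨?_, by omega, h4⟩
    rcases Nat.eq_zero_or_pos i with rfl | h0
    · exact absurd h4 (h.irrefl 0)
    · exact h0
  by_cases hout : ∃ k, 1 ≤ k ∧ k ≤ p + 1 - j ∧ R 0 (p + 1 - k)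
  · obtain ⟨h1, h2, h3⟩ := Nat.find_spec hout
    refine h.reverse.false_of_uncrossed_of_le (t := Nat.find hout) ?_ h1 h2 ?_ ?_
    · intro d c h4 h5 h6
      rw [if_pos (Or.inl rfl), if_neg (by omega), if_neg (by omega)]
      exact fun h7 h8 => hunc (p + 1 - c) (p + 1 - d) (by omega) (by omega) (by omega) h8 h7
    · rwa [if_pos (Or.inl rfl), if_neg (by omega)]
    · intro i hi h4
      rw [if_pos (Or.inl rfl)] at h4
      rcases Nat.eq_zero_or_pos i with rfl | h0
      · rw [if_pos (Or.inl rfl)] at h4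
        exact h.irrefl 0 h4
      · rw [if_neg (by omega)] at h4
        exact Nat.find_min hout hi ⟨h0, by omega, h4⟩
  · refine h.false_of_separated (fun i hi hin' h0 => ?_) fun i hi h0 => ?_
    · by_cases hip : i ≤ p
      · exact hout ⟨p + 1 - i, by omega, by omega, by rwa [show p + 1 - (p + 1 - i) = i by omega]⟩
      · exact h.not_from_zero i (by omega) hin' h0
    · rcases Nat.eq_zero_or_pos i with rfl | h1
      · exact h.irrefl 0 h0
      · exact hin ⟨i, h1, hi, h0⟩

end Attached

/-! ### Crossings that cut out exactly `b` vertices -/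

/-- A longest possible cycle `0, 1, …, p` together with arcs `d → 0 → c` that cut out an interval
`d + 1, …, c - 1` of exactly `b` vertices. Both this interval and the set of outer vertices are
then left out by some longest possible cycle; the outer vertices are attached with threshold `j`
and the interval with threshold `t`, both in `c, …, p`. -/
structure TightCrossing (n b p j d c t : ℕ) (R : ℕ → ℕ → Prop) : Prop
    extends Attached n b p j R where
  one_le_left : 1 ≤ d
  right_eq : c = d + b + 1
  right_le : c ≤ j
  to_zero : R d 0
  from_zero : R 0 c
  right_le_seg : c ≤ t
  seg_le : t ≤ p
  seg_out : ∀ s i, d < s → s < c → c ≤ i → i ≤ t → R s i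
  of_seg_out : ∀ s w, d < s → s < c → w < n → R s w → d < w ∧ w ≤ t
  seg_in : ∀ s i, d < s → s < c → t ≤ i → i ≤ p → R i s
  left_in : ∀ s i, d < s → s < c → 1 ≤ i → i ≤ d → R i s
  zero_seg : ∀ s, d < s → s < c → ¬ R 0 s

namespace TightCrossing

variable {n b p j d c t : ℕ} {R : ℕ → ℕ → Prop}

theorem arith (h : TightCrossing n b p j d c t R) : 2 ≤ b ∧ n = p + b + 1 ∧ j ≤ p ∧ 1 ≤ d ∧
    c = d + b + 1 ∧ c ≤ j ∧ c ≤ t ∧ t ≤ p :=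
  ⟨h.two_le, h.card_eq, h.le_length, h.one_le_left, h.right_eq, h.right_le,
    h.right_le_seg, h.seg_le⟩

theorem seg_le_attach (h : TightCrossing n b p j d c t R) : t ≤ j := by
  obtain ⟨hb, hn, hjp, hd, hc, hcj, hct, htp⟩ := h.arith
  by_contra hcon
  refine h.no_long_cycle h.path 0 [(c, j), (p + 1, n - 1), (1, c - 1), (j + 1, p)]
    (.cons_cons h.from_zero (.cons_cons (h.to_outer (by omega) (by omega) le_rfl hjp)
    (.cons_cons (h.to_one (by omega) (by omega) le_rfl h.one_le)
    (.cons_cons (h.seg_out _ _ (by omega) (by omega) (by omega) (by omega))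
    (.cons_cons h.close (.singleton _)))))) ?_ ?_ ?_
  · simp; omega
  · simp; omega
  · simp; omega

theorem not_arc_zero (h : TightCrossing n b p j d c t R) {a : ℕ} (hca : c ≤ a) (hat : a < t) :
    ¬ R a 0 := by
  intro ha
  obtain ⟨hb, hn, hjp, hd, hc, hcj, hct, htp⟩ := h.arith
  refine h.no_long_cycle h.path (c - 1) [(a + 1, n - 1), (c, a)]
    (.cons_cons (h.seg_out _ _ (by omega) (by omega) (by omega) (by omega))
    (.cons_cons (h.to_one (by omega) (by omega) (by omega) hcj)
    (.cons_cons ha (.singleton _)))) ?_ ?_ ?_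
  · simp; omega
  · simp; omega
  · simp; omega

theorem not_jump (h : TightCrossing n b p j d c t R) {u v f : ℕ} (hcu : c ≤ u) (huv : u < v)
    (hvu : v ≤ u + 2) (hvf : v < f) (htf : t < f) (hfp : f ≤ p) (h0v : R 0 v) : ¬ R u f := by
  intro huf
  obtain ⟨hb, hn, hjp, hd, hc, hcj, hct, htp⟩ := h.arith
  refine h.no_long_cycle h.path 0 [(v, f - 1), (d + 1, u), (f, n - 1), (1, d)]
    (.cons_cons h0v (.cons_cons (h.seg_in _ _ (by omega) (by omega) (by omega) (by omega))
    (.cons_cons huf (.cons_cons (h.to_one (by omega) (by omega) le_rfl h.one_le)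
    (.cons_cons h.to_zero (.singleton _)))))) ?_ ?_ ?_
  · simp; omega
  · simp; omega
  · simp; omega

theorem not_back (h : TightCrossing n b p j d c t R) {u v i : ℕ} (hcu : c ≤ u) (huv : u < v)
    (hvu : v ≤ u + 2) (hvp : v ≤ p) (hi : 1 ≤ i) (hid : i ≤ d) (h0v : R 0 v) : ¬ R u i := by
  intro hui
  obtain ⟨hb, hn, hjp, hd, hc, hcj, hct, htp⟩ := h.arith
  rcases Nat.lt_or_ge 1 i with h1 | h1
  · refine h.no_long_cycle h.path 0 [(v, n - 1), (1, i - 1), (d + 1, u), (i, d)]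
      (.cons_cons h0v (.cons_cons (h.to_one (by omega) (by omega) le_rfl h.one_le)
      (.cons_cons (h.left_in _ _ (by omega) (by omega) (by omega) (by omega))
      (.cons_cons hui (.cons_cons h.to_zero (.singleton _)))))) ?_ ?_ ?_
    · simp; omega
    · simp; omega
    · simp; omega
  · obtain rfl : i = 1 := by omega
    refine h.no_long_cycle h.path 0 [(v, n - 1), (d + 1, u), (1, d)]
      (.cons_cons h0v (.cons_cons (h.to_one (by omega) (by omega) (by omega) (by omega))
      (.cons_cons hui (.cons_cons h.to_zero (.singleton _))))) ?_ ?_ ?_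
    · simp; omega
    · simp; omega
    · simp; omega

/-- Among the pairs of consecutive vertices from `c` on, at most one is missed by `0`, since the
pair `d + 1`, `d + 2` is missed already. -/
theorem pair_of_missed (h : TightCrossing n b p j d c t R) {a i : ℕ} (hca : c ≤ a) (hap : a ≤ p)
    (ha : ¬ R a 0) (ha' : ¬ R 0 (a + 1)) (hi : c ≤ i) (hip : i ≤ p) (hia : i ≠ a) :
    R i 0 ∨ R 0 (i + 1) := by
  obtain ⟨hb, hn, hjp, hd, hc, hcj, hct, htp⟩ := h.arith
  have h0 : ¬ R (d + 1) 0 := fun h1 => by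
    have := h.of_seg_out (d + 1) 0 (by omega) (by omega) (by omega) h1
    omega
  exact h.pair_of_ne (a := d + 1) (c := a) (by omega) (by omega) hia
    ⟨by omega, h0, h.zero_seg _ (by omega) (by omega)⟩ ⟨hap, ha, ha'⟩ hip

/-- If `0` misses the pair `t - 1`, `t`, but `t → 0`, then all later vertices have arcs to `0`. -/
theorem to_zero_of_le (h : TightCrossing n b p j d c t R) (hct' : c < t) (h0t : ¬ R 0 t)
    (ht0 : R t 0) {i : ℕ} (hti : t ≤ i) (hip : i ≤ p) : R i 0 := by
  obtain ⟨hb, hn, hjp, hd, hc, hcj, hct, htp⟩ := h.arith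
  induction i, hti using Nat.le_induction with
  | base => exact ht0
  | succ i hti ih =>
    rcases Nat.lt_or_ge (i + 1) p with h1 | h1
    · refine (h.pair_of_missed (a := t - 1) (by omega) (by omega)
        (h.not_arc_zero (by omega) (by omega)) (by rwa [show t - 1 + 1 = t by omega])
        (by omega) hip (by omega)).resolve_right fun h2 => ?_
      have := h.gap_le (by omega) (by omega) (by omega) (ih (by omega)) h2
      omega
    · obtain rfl : i + 1 = p := by omega
      exact h.close

theorem from_zero_of_missed (h : TightCrossing n b p j d c t R) {a u : ℕ} (hca : c ≤ a)
    (hat : a < t) (ha : ¬ R 0 (a + 1)) (hcu : c ≤ u) (hut : u < t) (hua : u ≠ a) : R 0 (u + 1) := by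
  obtain ⟨hb, hn, hjp, hd, hc, hcj, hct, htp⟩ := h.arith
  exact (h.pair_of_missed hca (by omega) (h.not_arc_zero hca hat) ha hcu (by omega)
    hua).resolve_left (h.not_arc_zero hcu hut)

/-- No arc jumps over `t`. -/
theorem not_arc_over (h : TightCrossing n b p j d c t R) {a e : ℕ} (hca : c ≤ a) (hat : a < t)
    (hte : t < e) (hep : e ≤ p) : ¬ R a e := by
  intro hae
  obtain ⟨hb, hn, hjp, hd, hc, hcj, hct, htp⟩ := h.arith
  have htj := h.seg_le_attach
  have h1 : ¬ R 0 (a + 1) := fun h0 =>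
    h.not_jump hca (by omega) (by omega) (by omega) hte hep h0 hae
  obtain rfl : t = a + 1 := by
    by_contra hne
    exact h.not_jump (v := a + 2) hca (by omega) (by omega) (by omega) hte hep
      (h.from_zero_of_missed hca hat h1 (u := a + 1) (by omega) (by omega) (by omega)) hae
  have h2 : ¬ R (e - 1) 0 := fun h2 => by
    refine h.no_long_cycle h.path 0 [(c, a), (e, n - 1), (1, c - 1), (a + 1, e - 1)]
      (.cons_cons h.from_zero (.cons_cons hae
      (.cons_cons (h.to_one (by omega) (by omega) le_rfl h.one_le)
      (.cons_cons (h.seg_out _ _ (by omega) (by omega) (by omega) (by omega))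
      (.cons_cons h2 (.singleton _)))))) ?_ ?_ ?_
    · simp; omega
    · simp; omega
    · simp; omega
  have h3 : ¬ R (a + 1) 0 := fun h3 =>
    h2 (h.to_zero_of_le (by omega) h1 h3 (by omega) (by omega))
  have h4 : R 0 (a + 1 + 1) := (h.pair_of_missed hca (by omega) (h.not_arc_zero hca hat) h1
    (i := a + 1) (by omega) (by omega) (by omega)).resolve_left h3
  obtain rfl : e = a + 2 := by
    by_contra hne
    exact h.not_jump (v := a + 2) hca (by omega) (by omega) (by omega) hte hep h4 hae
  have h5 : a + 2 ≤ j := by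
    by_contra h5
    refine h.no_long_cycle h.path (c - 1) [(a + 1, a + 1), (p + 1, n - 1), (c, a), (a + 2, p)]
      (.cons_cons (h.seg_out _ _ (by omega) (by omega) (by omega) (by omega))
      (.cons_cons (h.to_outer (by omega) (by omega) (by omega) (by omega))
      (.cons_cons (h.to_one (by omega) (by omega) (by omega) (by omega))
      (.cons_cons hae (.cons_cons h.close (.singleton _)))))) ?_ ?_ ?_
    · simp; omega
    · simp; omega
    · simp; omega
  -- now `a + 2` would separate the interval `d + 1, …, a + 1` from the rest
  obtain ⟨u, w, w1, w2, w3, w4, w5, w6, w7⟩ := h.cut (a + 2) (by omega)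
    (fun i => d < i ∧ i < a + 2) ⟨d + 1, by omega, by omega, by omega⟩
    ⟨0, by omega, by omega, by omega⟩
  have hcu : c ≤ u := by
    by_contra hcu
    have := h.of_seg_out u w w5.1 (by omega) w2 w7
    omega
  have hwp : w ≤ p := by
    by_contra hwp
    have := (h.in_iff w u (by omega) w2 (by omega) (by omega)).1 w7
    omega
  -- `0 → u + 1` or `0 → u + 2`
  obtain ⟨v, hv1, hv2, hv3, hv⟩ : ∃ v, u < v ∧ v ≤ u + 2 ∧ v ≤ a + 2 ∧ R 0 v := by
    by_cases hu : u + 1 = a + 1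
    · exact ⟨u + 2, by omega, by omega, by omega, by rwa [show u + 2 = a + 1 + 1 by omega]⟩
    by_cases hu' : u = a + 1
    · exact ⟨u + 1, by omega, by omega, by omega, by rwa [hu']⟩
    · exact ⟨u + 1, by omega, by omega, by omega,
        h.from_zero_of_missed hca hat h1 hcu (by omega) (by omega)⟩
  rcases Nat.eq_zero_or_pos w with rfl | hw
  · by_cases hu' : u = a + 1
    · exact h3 (by rwa [← hu'])
    · exact h.not_arc_zero hcu (by omega) w7
  by_cases hwd : w ≤ d
  · exact h.not_back hcu hv1 hv2 (by omega) hw hwd hv w7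
  · exact h.not_jump hcu hv1 hv2 (by omega) (by omega) hwp hv w7

/-- An arc from `c, …, t - 1` back to `1, …, d` exists in one extreme case at most. -/
theorem arc_back (h : TightCrossing n b p j d c t R) {a i : ℕ} (hca : c ≤ a) (hat : a < t)
    (hi : 1 ≤ i) (hid : i ≤ d) (hai : R a i) : d = 1 ∧ ¬ R 0 t ∧ R t 0 ∧ c < t := by
  obtain ⟨hb, hn, hjp, hd, hc, hcj, hct, htp⟩ := h.arith
  have h1 : ¬ R 0 (a + 1) := fun h0 =>
    h.not_back hca (by omega) (by omega) (by omega) hi hid h0 hai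
  obtain rfl : t = a + 1 := by
    by_contra hne
    exact h.not_back (v := a + 2) hca (by omega) (by omega) (by omega) hi hid
      (h.from_zero_of_missed hca hat h1 (u := a + 1) (by omega) (by omega) (by omega)) hai
  have h2 : R (a + 1) 0 := by
    rcases Nat.lt_or_ge (a + 1) p with h2 | h2
    · exact (h.pair_of_missed hca (by omega) (h.not_arc_zero hca hat) h1
        (i := a + 1) (by omega) (by omega) (by omega)).resolve_right fun h3 =>
          h.not_back (v := a + 2) hca (by omega) (by omega) (by omega) hi hid h3 hai
    · rw [show a + 1 = p by omega]
      exact h.close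
  refine ⟨?_, h1, h2, by omega⟩
  by_contra hd1
  rcases Nat.lt_or_ge 1 i with h3 | h3
  · refine h.no_long_cycle h.path (i - 1) [(d + 1, c - 1), (a + 1, n - 1), (c, a), (i, d)]
      (.cons_cons (h.left_in _ _ (by omega) (by omega) (by omega) (by omega))
      (.cons_cons (h.seg_out _ _ (by omega) (by omega) (by omega) (by omega))
      (.cons_cons (h.to_one (by omega) (by omega) (by omega) (by omega))
      (.cons_cons hai (.cons_cons h.to_zero (.singleton _)))))) ?_ ?_ ?_
    · simp; omega
    · simp; omega
    · simp; omega
  · obtain rfl : i = 1 := by omega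
    refine h.no_long_cycle h.path 0 [(c, a), (1, 1), (d + 1, c - 1), (a + 1, n - 1), (2, d)]
      (.cons_cons h.from_zero (.cons_cons hai
      (.cons_cons (h.left_in _ _ (by omega) (by omega) (by omega) (by omega))
      (.cons_cons (h.seg_out _ _ (by omega) (by omega) (by omega) (by omega))
      (.cons_cons (h.to_one (by omega) (by omega) (by omega) (by omega))
      (.cons_cons h.to_zero (.singleton _))))))) ?_ ?_ ?_
    · simp; omega
    · simp; omega
    · simp; omega

theorem contradiction (h : TightCrossing n b p j d c t R) : False := by
  obtain ⟨hb, hn, hjp, hd, hc, hcj, hct, htp⟩ := h.arith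
  have htj := h.seg_le_attach
  -- if `t` is deleted, the interval `d + 1, …, t - 1` is left by an arc back to `1, …, d` only
  obtain ⟨u, w, w1, w2, w3, w4, w5, w6, w7⟩ := h.cut t (by omega)
    (fun i => d < i ∧ i < t) ⟨d + 1, by omega, by omega, by omega⟩
    ⟨0, by omega, by omega, by omega⟩
  have hcu : c ≤ u := by
    by_contra hcu
    have := h.of_seg_out u w w5.1 (by omega) w2 w7
    omega
  have houter : ∀ u w, c ≤ u → u < t → p < w → w < n → ¬ R u w := by
    intro u w h1 h2 h3 h4 h5
    have := (h.in_iff w u h3 h4 (by omega) (by omega)).1 h5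
    omega
  have hwd : 1 ≤ w ∧ w ≤ d := by
    constructor
    · rcases Nat.eq_zero_or_pos w with rfl | hw
      · exact absurd w7 (h.not_arc_zero hcu w5.2)
      · exact hw
    · by_contra hwd
      by_cases hwp : w ≤ p
      · exact h.not_arc_over hcu w5.2 (by omega) hwp w7
      · exact houter u w hcu w5.2 (by omega) w2 w7
  obtain ⟨rfl, h0t, ht0, hct'⟩ := h.arc_back hcu w5.2 hwd.1 hwd.2 w7
  have hu : u = t - 1 := by
    by_contra hu
    exact h.not_back (v := u + 1) hcu (by omega) (by omega) (by omega) hwd.1 hwd.2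
      (h.from_zero_of_missed (a := t - 1) (by omega) (by omega)
        (by rwa [show t - 1 + 1 = t by omega]) hcu w5.2 hu) w7
  obtain rfl : w = 1 := by omega
  subst hu
  -- in that case `t` separates the interval `0, …, t - 1` from the rest
  obtain ⟨u, w, v1, v2, v3, v4, v5, v6, v7⟩ := h.cut t (by omega)
    (fun i => i < t) ⟨0, by omega, by omega, by omega⟩ ⟨p + 1, by omega, by omega, by omega⟩
  rcases Nat.lt_or_ge u c with h1 | h1
  · have hu2 : u ≤ 1 := by
      by_contra hu2
      have := h.of_seg_out u w (by omega) h1 v2 v7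
      omega
    have hwp : w ≤ p := by
      by_contra hwp
      rcases Nat.eq_zero_or_pos u with rfl | hu
      · exact h.not_from_zero w (by omega) v2 v7
      · have := (h.in_iff w u (by omega) v2 (by omega) (by omega)).1 v7
        omega
    rcases Nat.eq_zero_or_pos u with rfl | hu
    · have := h.gap_le (d := w - 1) (c := w) (by omega) (by omega) hwp
        (h.to_zero_of_le hct' h0t ht0 (by omega) (by omega)) v7
      omega
    · obtain rfl : u = 1 := by omega
      refine h.no_long_cycle h.path 0
        [(c, t - 1), (1, 1), (w, n - 1), (2, c - 1), (t, w - 1)]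
        (.cons_cons h.from_zero (.cons_cons w7 (.cons_cons v7
        (.cons_cons (h.to_one (by omega) (by omega) (by omega) (by omega))
        (.cons_cons (h.seg_out _ _ (by omega) (by omega) (by omega) (by omega))
        (.cons_cons (h.to_zero_of_le hct' h0t ht0 (by omega) (by omega)) (.singleton _)))))))
        ?_ ?_ ?_
      · simp; omega
      · simp; omega
      · simp; omega
  · by_cases hwp : w ≤ p
    · exact h.not_arc_over h1 v5 (by omega) hwp v7
    · exact houter u w h1 v5 (by omega) v2 v7

end TightCrossing

/-! ### Rotation of the cycle -/

/-- The permutation of the vertices that keeps `0` and rotates the list `1, …, n - 1` to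
`c, …, n - 1, 1, …, c - 1`. -/
def rotateTail (n c i : ℕ) : ℕ :=
  if i = 0 ∨ n ≤ i then i else if i + c ≤ n then i + (c - 1) else i + c - n

theorem rotateTail_zero (n c : ℕ) : rotateTail n c 0 = 0 := if_pos (Or.inl rfl)

theorem rotateTail_of_le {n c i : ℕ} (hi : 1 ≤ i) (hc : 1 ≤ c) (hic : i + c ≤ n) :
    rotateTail n c i = i + (c - 1) := by
  unfold rotateTail
  rw [if_neg (by omega), if_pos hic]

theorem rotateTail_of_lt {n c i : ℕ} (hin : i < n) (hic : n < i + c) (hi : 1 ≤ i) :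
    rotateTail n c i = i + c - n := by
  unfold rotateTail
  rw [if_neg (by omega), if_neg (by omega)]

theorem rotateTail_rotateTail {n c c' : ℕ} (hc : 1 ≤ c) (hc' : 1 ≤ c')
    (h : c + c' = n + 1) (i : ℕ) :
    rotateTail n c (rotateTail n c' i) = i := by
  unfold rotateTail
  grind

theorem ExtremalRel.rotate {n b c : ℕ} {R : ℕ → ℕ → Prop} (h : ExtremalRel n b R) (hc : 1 ≤ c)
    (hcn : c < n) : ExtremalRel n b (fun i k => R (rotateTail n c i) (rotateTail n c k)) := by
  refine h.comp (rotateTail n c) (fun i hi => ?_) (fun i hi k hk hik => ?_) (rotateTail_zero n c)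
  · unfold rotateTail
    grind
  · unfold rotateTail at hik
    grind

namespace Attached

variable {n b p j : ℕ} {R : ℕ → ℕ → Prop}

/-- If `d → 0 → c` with `c = d + b + 1`, then `0, c, …, n - 1, 1, …, d` is a longest possible
cycle, too. -/
theorem rotate (h : Attached n b p j R) {d c : ℕ} (hd : 1 ≤ d) (hc : c = d + b + 1) (hcp : c ≤ p)
    (hd0 : R d 0) (h0c : R 0 c) :
    LongCycle n b p (fun i k => R (rotateTail n c i) (rotateTail n c k)) := by
  have hb := h.two_le
  have hn := h.card_eq
  refine ⟨h.toExtremalRel.rotate (by omega) (by omega), hn, fun i hi => ?_, ?_⟩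
  · rcases Nat.eq_zero_or_pos i with rfl | hi0
    · rw [rotateTail_zero, rotateTail_of_le (by omega) (by omega) (by omega)]
      rwa [show 0 + 1 + (c - 1) = c by omega]
    by_cases h1 : i + c + 1 ≤ n
    · rw [rotateTail_of_le (by omega) (by omega) (by omega),
        rotateTail_of_le (by omega) (by omega) (by omega)]
      have := h.path (i + (c - 1)) (by omega)
      rwa [show i + 1 + (c - 1) = i + (c - 1) + 1 by omega]
    by_cases h2 : i + c ≤ n
    · rw [rotateTail_of_le (by omega) (by omega) h2,
        rotateTail_of_lt (by omega) (by omega) (by omega)]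
      exact h.to_one (by omega) (by omega) (by omega) (by have := h.one_le; omega)
    · rw [rotateTail_of_lt (by omega) (by omega) (by omega),
        rotateTail_of_lt (by omega) (by omega) (by omega)]
      have := h.path (i + c - n) (by omega)
      rwa [show i + 1 + c - n = i + c - n + 1 by omega]
  · rw [rotateTail_zero, rotateTail_of_lt (by omega) (by omega) (by omega)]
    rwa [show p + c - n = d by omega]

/-- If the interval between `d` and `c` has `b` vertices and `c ≤ j`, the outer vertices and the
interval form a tight crossing. -/
theorem tightCrossing (h : Attached n b p j R) {d c j' : ℕ} (hd : 1 ≤ d) (hc : c = d + b + 1)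
    (hcj : c ≤ j) (hd0 : R d 0) (h0c : R 0 c)
    (h' : Attached n b p j' (fun i k => R (rotateTail n c i) (rotateTail n c k))) :
    TightCrossing n b p j d c (j' + c - 1) R := by
  have hb := h.two_le
  have hn := h.card_eq
  have hjp := h.le_length
  have h1j' := h'.one_le
  have hj'p := h'.le_length
  have rseg : ∀ s, d < s → s < c → rotateTail n c (s + n - c) = s := by
    intro s h1 h2
    rw [rotateTail_of_lt (by omega) (by omega) (by omega)]
    omega
  have rright : ∀ i, c ≤ i → i < n → rotateTail n c (i - (c - 1)) = i := by
    intro i h1 h2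
    rw [rotateTail_of_le (by omega) (by omega) (by omega)]
    omega
  have rleft : ∀ i, 1 ≤ i → i ≤ d → rotateTail n c (i + n - c) = i := by
    intro i h1 h2
    rw [rotateTail_of_lt (by omega) (by omega) (by omega)]
    omega
  have sright : ∀ s i, d < s → s < c → c ≤ i → i + 1 ≤ p + c → i < n →
      (R s i ↔ i ≤ j' + c - 1) := by
    intro s i h1 h2 h3 h4 h5
    have := h'.out_iff (s + n - c) (i - (c - 1)) (by omega) (by omega) (by omega) (by omega)
    rw [rseg s h1 h2, rright i h3 h5] at this
    rw [this]
    omega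
  -- the interval has arcs from, but not to, the outer vertices
  have hseg : j' + c - 1 ≤ p := by
    by_contra hcon
    have h1 := (sright (d + 1) (p + 1) (by omega) (by omega) (by omega) (by omega) (by omega)).2
      (by omega)
    have := (h.in_iff (p + 1) (d + 1) (by omega) (by omega) (by omega) (by omega)).1 h1
    omega
  refine ⟨h, hd, hc, hcj, hd0, h0c, by omega, hseg, ?_, ?_, ?_, ?_, ?_⟩
  · intro s i h1 h2 h3 h4
    exact (sright s i h1 h2 h3 (by omega) (by omega)).2 h4
  · intro s w h1 h2 h3 h4
    rcases Nat.eq_zero_or_pos w with rfl | hw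
    · have := h'.not_to_zero (s + n - c) (by omega) (by omega)
      rw [rseg s h1 h2, rotateTail_zero] at this
      exact absurd h4 this
    by_cases hwd : w ≤ d
    · have := (h'.out_iff (s + n - c) (w + n - c) (by omega) (by omega) (by omega) (by omega)).1
        (by rwa [rseg s h1 h2, rleft w hw hwd])
      omega
    refine ⟨by omega, ?_⟩
    by_cases hwc : w < c
    · omega
    by_cases hwp : w ≤ p
    · exact (sright s w h1 h2 (by omega) (by omega) h3).1 h4
    · have := (h.in_iff w s (by omega) h3 (by omega) (by omega)).1 h4
      omega
  · intro s i h1 h2 h3 h4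
    have := (h'.in_iff (s + n - c) (i - (c - 1)) (by omega) (by omega) (by omega) (by omega)).2
      (by omega)
    rwa [rseg s h1 h2, rright i (by omega) (by omega)] at this
  · intro s i h1 h2 h3 h4
    have := (h'.in_iff (s + n - c) (i + n - c) (by omega) (by omega) (by omega) (by omega)).2
      (by omega)
    rwa [rseg s h1 h2, rleft i (by omega) (by omega)] at this
  · intro s h1 h2
    have := h'.not_from_zero (s + n - c) (by omega) (by omega)
    rwa [rseg s h1 h2, rotateTail_zero] at this

/-- If `d → 0 → c` with `d < c`, then more than `b` vertices lie between `d` and `c`. -/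
theorem gap_ne (h : Attached n b p j R) {d c : ℕ} (hd : 1 ≤ d) (hcp : c ≤ p)
    (hd0 : R d 0) (h0c : R 0 c) : c ≠ d + b + 1 := by
  intro hc
  have hb := h.two_le
  have hn := h.card_eq
  have hjp := h.le_length
  obtain ⟨j', h'⟩ := (h.rotate hd hc hcp hd0 h0c).exists_attached
  by_cases hcj : c ≤ j
  · exact (h.tightCrossing hd hc hcj hd0 h0c h').contradiction
  have rseg : rotateTail n c (p + 1) = d + 1 := by
    rw [rotateTail_of_lt (by omega) (by omega) (by omega)]
    omega
  have rouz : ∀ y, p < y → y < n → rotateTail n c (y - (c - 1)) = y := by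
    intro i h1 h2
    rw [rotateTail_of_le (by omega) (by omega) (by omega)]
    omega
  have rseg' : ∀ s, d < s → s < c → rotateTail n c (s + n - c) = s := by
    intro s h1 h2
    rw [rotateTail_of_lt (by omega) (by omega) (by omega)]
    omega
  by_cases hjd : j ≤ d
  · -- the interval and the outer vertices exchange their roles
    have hj' : n - c + 1 ≤ j' := by
      by_contra hcon
      have h1 := (h'.in_iff (p + 1) (n - c) (by omega) (by omega) (by omega) (by omega)).2
        (by omega)
      have h2 := rouz (n - 1) (by omega) (by omega)
      rw [show n - 1 - (c - 1) = n - c by omega] at h2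
      rw [rseg, h2] at h1
      have := (h.out_iff (n - 1) (d + 1) (by omega) (by omega) (by omega) (by omega)).1 h1
      omega
    have hrot : (fun i k => (fun i k => R (rotateTail n c i) (rotateTail n c k))
        (rotateTail n (n - c + 1) i) (rotateTail n (n - c + 1) k)) = R := by
      funext i k
      simp only
      rw [rotateTail_rotateTail (by omega) (by omega) (by omega),
        rotateTail_rotateTail (by omega) (by omega) (by omega)]
    refine (h'.tightCrossing (d := p - c + 1) (c := n - c + 1) (j' := j) (by omega) (by omega) hj'
      ?_ ?_ (by rw [hrot]; exact h)).contradiction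
    · rw [rotateTail_zero, rotateTail_of_le (by omega) (by omega) (by omega),
        show p - c + 1 + (c - 1) = p by omega]
      exact h.close
    · rw [rotateTail_zero, rotateTail_of_lt (by omega) (by omega) (by omega),
        show n - c + 1 + c - n = 0 + 1 by omega]
      exact h.arc 0 (by omega)
  · -- a vertex of the interval would be joined in both directions to several outer vertices
    have h1 := (h'.out_iff (j + n - c) (p + 2 - (c - 1)) (by omega) (by omega) (by omega)
      (by omega)).1 (by
        rw [rseg' j (by omega) (by omega), rouz (p + 2) (by omega) (by omega)]
        exact h.to_outer (by omega) (by omega) le_rfl hjp)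
    have h2 := (h'.in_iff (j + n - c) (p + 1 - (c - 1)) (by omega) (by omega) (by omega)
      (by omega)).1 (by
        rw [rseg' j (by omega) (by omega), rouz (p + 1) (by omega) (by omega)]
        exact h.to_one (by omega) (by omega) h.one_le le_rfl)
    omega

end Attached

/-! ### Crossings that cut out three vertices -/

/-- The renumbering that moves the vertex `y` to the place after `a`. -/
def insertAfter (a y i : ℕ) : ℕ :=
  if i ≤ a then i else if i = a + 1 then y else if i ≤ y then i - 1 else i

/-- If three vertices are left out by the cycle `0, 1, …, e`, and one of them can be inserted into
it, a longest possible cycle results. -/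
theorem ExtremalRel.insert_longCycle {n e a y : ℕ} {R : ℕ → ℕ → Prop} (h : ExtremalRel n 2 R)
    (hn : n = e + 4) (harc : ∀ i < e, R i (i + 1)) (hclose : R e 0) (hey : e < y) (hyn : y < n)
    (hae : a < e) (hay : R a y) (hya : R y (a + 1)) :
    LongCycle n 2 (e + 1) (fun i k => R (insertAfter a y i) (insertAfter a y k)) := by
  refine ⟨h.comp (insertAfter a y) ?_ ?_ ?_, by omega, ?_, ?_⟩
  · intro i hi
    unfold insertAfter
    split_ifs <;> omega
  · intro i hi k hk hik
    unfold insertAfter at hik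
    split_ifs at hik <;> omega
  · unfold insertAfter
    split_ifs <;> omega
  · intro i hi
    unfold insertAfter
    rcases Nat.lt_trichotomy i a with h1 | rfl | h1
    · rw [if_pos (by omega), if_pos (by omega)]
      exact harc i (by omega)
    · rw [if_pos (by omega), if_neg (by omega), if_pos rfl]
      exact hay
    · rw [if_neg (by omega), if_neg (show ¬ i + 1 ≤ a by omega),
        if_neg (show ¬ i + 1 = a + 1 by omega), if_pos (show i + 1 ≤ y by omega)]
      by_cases h2 : i = a + 1
      · rw [if_pos h2, show i + 1 - 1 = a + 1 by omega]
        exact hya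
      · rw [if_neg h2, if_pos (by omega)]
        have := harc (i - 1) (by omega)
        rwa [show i + 1 - 1 = i - 1 + 1 by omega]
  · unfold insertAfter
    rw [if_neg (by omega), if_neg (by omega), if_pos (by omega), if_pos (by omega)]
    exact hclose

/-- What the degree of `0` leaves of a crossing `d → 0 → c` with more than `b` vertices between `d`
and `c`: there are three vertices in between, none of them is adjacent to `0`, and `0` misses no
other pair of consecutive vertices. -/
structure WideCrossing (n p j d : ℕ) (R : ℕ → ℕ → Prop) : Prop extends Attached n 2 p j R where
  one_le_left : 1 ≤ d
  right_le : d + 4 ≤ p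
  to_zero : R d 0
  from_zero : R 0 (d + 4)
  not_to : ∀ i, d < i → i < d + 4 → ¬ R i 0
  not_from : ∀ i, d < i → i < d + 4 → ¬ R 0 i
  pair : ∀ i, 1 ≤ i → i < p → i < d ∨ d + 4 ≤ i → R i 0 ∨ R 0 (i + 1)

theorem Attached.exists_wideCrossing {n b p j : ℕ} {R : ℕ → ℕ → Prop} (h : Attached n b p j R) :
    b = 2 ∧ ∃ d, WideCrossing n p j d R := by
  classical
  have hb := h.two_le
  have hn := h.card_eq
  have hex : ∃ g d, 1 ≤ d ∧ 0 < g ∧ d + g ≤ p ∧ R d 0 ∧ R 0 (d + g) := by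
    obtain ⟨d, c, h1, h2, h3, h4, h5⟩ := h.exists_crossing
    exact ⟨c - d, d, h1, by omega, by omega, h4, by rwa [show d + (c - d) = c by omega]⟩
  obtain ⟨d, h1, h2, h3, h4, h5⟩ := Nat.find_spec hex
  have hmin := @Nat.find_min _ _ hex
  set g := Nat.find hex
  have hto : ∀ i, d < i → i < d + g → ¬ R i 0 := by
    intro i hi hi' h0
    exact hmin (m := d + g - i) (by omega) ⟨i, by omega, by omega, by omega, h0,
      by rwa [show i + (d + g - i) = d + g by omega]⟩
  have hfrom : ∀ i, d < i → i < d + g → ¬ R 0 i := by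
    intro i hi hi' h0
    exact hmin (m := i - d) (by omega) ⟨d, by omega, by omega, by omega, h4,
      by rwa [show d + (i - d) = i by omega]⟩
  have h6 := h.gap_le h1 (by omega) h3 h4 h5
  have h7 := h.gap_ne h1 h3 h4 h5
  have hg : g ≤ 4 := by
    by_contra hg
    have hmiss : ∀ i, d < i → i + 1 < d + g → i ≤ p ∧ ¬ R i 0 ∧ ¬ R 0 (i + 1) := fun i hi hi' =>
      ⟨by omega, hto i hi (by omega), hfrom (i + 1) (by omega) hi'⟩
    have := h.pair_of_ne (a := d + 1) (c := d + 2) (i := d + 3) (by omega) (by omega) (by omega)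
      (hmiss _ (by omega) (by omega)) (hmiss _ (by omega) (by omega)) (by omega)
    rcases this with h8 | h8
    · exact hto _ (by omega) (by omega) h8
    · exact hfrom _ (by omega) (by omega) h8
  have hg4 : g = 4 := by omega
  obtain rfl : b = 2 := by omega
  rw [hg4] at h3 h5 hto hfrom
  refine ⟨rfl, d, h, h1, h3, h4, h5, hto, hfrom, fun i hi hip hid => ?_⟩
  exact h.pair_of_ne (a := d + 1) (c := d + 2) (by omega) (by omega) (by omega)
    ⟨by omega, hto _ (by omega) (by omega), hfrom _ (by omega) (by omega)⟩
    ⟨by omega, hto _ (by omega) (by omega), hfrom _ (by omega) (by omega)⟩ (by omega)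

namespace WideCrossing

variable {n p j d : ℕ} {R : ℕ → ℕ → Prop}

theorem reverse (h : WideCrossing n p j d R) : WideCrossing n p (p + 1 - j) (p - d - 3)
    (fun i k =>
      R (if k = 0 ∨ p < k then k else p + 1 - k) (if i = 0 ∨ p < i then i else p + 1 - i)) := by
  have hd := h.one_le_left
  have hdp := h.right_le
  refine ⟨h.toAttached.reverse, by omega, by omega, ?_, ?_, ?_, ?_, ?_⟩
  · rw [if_pos (Or.inl rfl), if_neg (by omega), show p + 1 - (p - d - 3) = d + 4 by omega]
    exact h.from_zero
  · rw [if_neg (by omega), if_pos (Or.inl rfl), show p + 1 - (p - d - 3 + 4) = d by omega]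
    exact h.to_zero
  · intro i h1 h2
    rw [if_pos (Or.inl rfl), if_neg (by omega)]
    exact h.not_from _ (by omega) (by omega)
  · intro i h1 h2
    rw [if_neg (by omega), if_pos (Or.inl rfl)]
    exact h.not_to _ (by omega) (by omega)
  · intro i h1 h2 h3
    rw [if_pos (Or.inl rfl), if_neg (by omega), if_neg (by omega)]
    have := h.pair (p + 1 - (i + 1)) (by omega) (by omega) (by omega)
    rw [show p + 1 - (i + 1) + 1 = p + 1 - i by omega] at this
    exact this.symm

/-- The cycle `0, d + 4, …, n - 1, 1, …, d` that leaves out `d + 1`, `d + 2`, `d + 3`, as an initial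
segment of the renumbering. -/
theorem rotate_arc (h : WideCrossing n p j d R) (i : ℕ) (hi : i + 1 < n) :
    R (rotateTail n (d + 4) i) (rotateTail n (d + 4) (i + 1)) := by
  have hn := h.card_eq
  have hd := h.one_le_left
  have hdp := h.right_le
  rcases Nat.eq_zero_or_pos i with rfl | hi0
  · rw [rotateTail_zero, rotateTail_of_le (by omega) (by omega) (by omega)]
    rw [show 0 + 1 + (d + 4 - 1) = d + 4 by omega]
    exact h.from_zero
  by_cases h1 : i + (d + 4) + 1 ≤ n
  · rw [rotateTail_of_le (by omega) (by omega) (by omega),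
      rotateTail_of_le (by omega) (by omega) (by omega)]
    have := h.path (i + (d + 4 - 1)) (by omega)
    rwa [show i + 1 + (d + 4 - 1) = i + (d + 4 - 1) + 1 by omega]
  by_cases h2 : i + (d + 4) ≤ n
  · rw [rotateTail_of_le (by omega) (by omega) h2,
      rotateTail_of_lt (by omega) (by omega) (by omega)]
    exact h.to_one (by omega) (by omega) (by omega) (by have := h.one_le; omega)
  · rw [rotateTail_of_lt (by omega) (by omega) (by omega),
      rotateTail_of_lt (by omega) (by omega) (by omega)]
    have := h.path (i + (d + 4) - n) (by omega)
    rwa [show i + 1 + (d + 4) - n = i + (d + 4) - n + 1 by omega]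

/-- The threshold `j` of the outer vertices is not one of `d + 1`, `d + 2`, `d + 3`: otherwise `j`
could be inserted between the two outer vertices. -/
theorem threshold_not_between (h : WideCrossing n p j d R) (hdj : d < j) : d + 4 ≤ j := by
  by_contra hcon
  have hn := h.card_eq
  have hd := h.one_le_left
  have hdp := h.right_le
  have hrot := h.toExtremalRel.rotate (c := d + 4) (by omega) (by omega)
  have hlong := hrot.insert_longCycle (e := n - 4) (a := p + 1 - (d + 3)) (y := j + n - (d + 4))
    (by omega) (fun i hi => h.rotate_arc i (by omega))
    (by
      rw [rotateTail_zero, rotateTail_of_lt (by omega) (by omega) (by omega),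
        show n - 4 + (d + 4) - n = d by omega]
      exact h.to_zero) (by omega) (by omega) (by omega)
    (by
      rw [rotateTail_of_le (by omega) (by omega) (by omega),
        rotateTail_of_lt (by omega) (by omega) (by omega)]
      exact h.to_one (by omega) (by omega) (by omega) (by omega))
    (by
      rw [rotateTail_of_lt (by omega) (by omega) (by omega),
        rotateTail_of_le (by omega) (by omega) (by omega)]
      exact h.to_outer (by omega) (by omega) (by omega) (by omega))
  obtain ⟨t, ht⟩ := hlong.exists_attached
  set τ : ℕ → ℕ := fun i =>
    rotateTail n (d + 4) (insertAfter (p + 1 - (d + 3)) (j + n - (d + 4)) i) with hτ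
  have hτ1 : τ (p + 1 - (d + 3)) = p + 1 := by
    simp only [hτ, insertAfter, rotateTail]; split_ifs <;> omega
  have hτ2 : τ (p + 1 - (d + 3) + 1) = j := by
    simp only [hτ, insertAfter, rotateTail]; split_ifs <;> omega
  have hτ3 : τ (p + 1 - (d + 3) + 2) = p + 2 := by
    simp only [hτ, insertAfter, rotateTail]; split_ifs <;> omega
  have hτ4 : τ (n - 2) = if j = d + 1 then d + 2 else d + 1 := by
    simp only [hτ, insertAfter, rotateTail]; split_ifs <;> omega
  have hτ5 : τ (n - 1) = if j = d + 3 then d + 2 else d + 3 := by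
    simp only [hτ, insertAfter, rotateTail]; split_ifs <;> omega
  have hout : ∀ y i, n - 4 + 1 < y → y < n → 1 ≤ i → i ≤ n - 4 + 1 → R (τ y) (τ i) → i ≤ t :=
    fun y i h1 h2 h3 h4 h5 => (ht.out_iff y i h1 h2 h3 h4).1 h5
  have hin : ∀ y i, n - 4 + 1 < y → y < n → 1 ≤ i → i ≤ n - 4 + 1 → R (τ i) (τ y) → t ≤ i :=
    fun y i h1 h2 h3 h4 h5 => (ht.in_iff y i h1 h2 h3 h4).1 h5
  by_cases hj1 : j = d + 1
  · have h1 := hout (n - 2) (p + 1 - (d + 3) + 2) (by omega) (by omega) (by omega) (by omega) (by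
      rw [hτ3, hτ4, if_pos hj1]
      exact h.to_outer (by omega) (by omega) (by omega) (by omega))
    have h2 := hin (n - 2) (p + 1 - (d + 3) + 1) (by omega) (by omega) (by omega) (by omega) (by
      rw [hτ2, hτ4, if_pos hj1, hj1]
      exact h.path _ (by omega))
    omega
  · have h1 := hin (n - 2) (p + 1 - (d + 3)) (by omega) (by omega) (by omega) (by omega) (by
      rw [hτ1, hτ4, if_neg hj1]
      exact h.to_one (by omega) (by omega) (by omega) (by omega))
    by_cases hj3 : j = d + 3
    · have h2 := hout (n - 1) (p + 1 - (d + 3) + 1) (by omega) (by omega) (by omega) (by omega) (by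
        rw [hτ2, hτ5, if_pos hj3, hj3]
        exact h.path _ (by omega))
      omega
    · have h2 := hout (n - 1) (p + 1 - (d + 3) + 2) (by omega) (by omega) (by omega) (by omega) (by
        rw [hτ3, hτ5, if_neg hj3]
        exact h.to_outer (by omega) (by omega) (by omega) (by omega))
      omega

/-- If the three vertices precede the threshold `j`, then `p` is the only vertex from `d + 4` on
with an arc to `0`. -/
theorem not_arc_zero (h : WideCrossing n p j d R) (hdj : d + 4 ≤ j) {i : ℕ} (hdi : d + 4 ≤ i)
    (hip : i < p) : ¬ R i 0 := by
  classical
  intro hi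
  have hn := h.card_eq
  have hd := h.one_le_left
  have hjp := h.le_length
  have hex : ∃ t, d + 4 ≤ t ∧ t < p ∧ R t 0 := ⟨i, hdi, hip, hi⟩
  obtain ⟨hdt, htp, ht0⟩ := Nat.find_spec hex
  have hmin : ∀ i, d + 4 ≤ i → i < Nat.find hex → ¬ R i 0 := fun i h1 h2 h3 =>
    Nat.find_min hex h2 ⟨h1, by omega, h3⟩
  set t := Nat.find hex
  have hlate : ∀ i, t ≤ i → i ≤ p → R i 0 ∧ ∀ k, i < k → k ≤ i + 2 → k < n → ¬ R 0 k := by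
    intro i hti
    have hgap : ∀ i, t ≤ i → R i 0 → ∀ k, i < k → k ≤ i + 2 → k < n → ¬ R 0 k := by
      intro i hti hi0 k h1 h2 h3 h0k
      by_cases hkp : k ≤ p
      · have := h.gap_le (by omega) h1 hkp hi0 h0k
        omega
      · exact h.not_from_zero k (by omega) h3 h0k
    induction i, hti using Nat.le_induction with
    | base => exact fun _ => ⟨ht0, hgap t le_rfl ht0⟩
    | succ i hti ih =>
      intro hip
      suffices h1 : R (i + 1) 0 from ⟨h1, hgap (i + 1) (by omega) h1⟩
      rcases Nat.lt_or_ge (i + 1) p with h1 | h1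
      · exact (h.pair (i + 1) (by omega) h1 (by omega)).resolve_right
          ((ih (by omega)).2 _ (by omega) (by omega) (by omega))
      · rw [show i + 1 = p by omega]
        exact h.close
  have hearly : ∀ i, d + 4 ≤ i → i ≤ t → R 0 i := by
    intro i h1 h2
    rcases Nat.eq_or_lt_of_le h1 with rfl | h3
    · exact h.from_zero
    · have := (h.pair (i - 1) (by omega) (by omega) (by omega)).resolve_left
        (hmin _ (by omega) (by omega))
      rwa [show i - 1 + 1 = i by omega] at this
  have hzero : ∀ w, t < w → w < n → ¬ R 0 w := by
    intro w h1 h2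
    by_cases hwp : w ≤ p
    · exact (hlate (w - 1) (by omega) (by omega)).2 w (by omega) (by omega) h2
    · exact h.not_from_zero w (by omega) h2
  have hjump : ∀ a e, 1 ≤ a → a < t → t < e → e ≤ p → ¬ R a e := by
    intro a e h1 h2 h3 h4 h5
    by_cases haj : a < j
    · exact h.not_jump_to_zero (v := e - 1) h1 haj (by omega) (by omega) h4 (by omega) h5
        (hlate (e - 1) (by omega) (by omega)).1
    · exact h.not_jump_from_zero h1 (by omega) (by omega) h4 h5 (hearly _ (by omega) (by omega))
  by_cases htj : t ≤ j
  · obtain ⟨u, w, h1, h2, h3, h4, h5, h6, h7⟩ := h.cut t (by omega) (fun i => i < t)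
      ⟨0, by omega, by omega, by omega⟩ ⟨p + 1, by omega, by omega, by omega⟩
    rcases Nat.eq_zero_or_pos u with rfl | hu
    · exact hzero w (by omega) h2 h7
    by_cases hwp : w ≤ p
    · exact hjump u w hu h5 (by omega) hwp h7
    · have := (h.in_iff w u (by omega) h2 (by omega) (by omega)).1 h7
      omega
  · obtain ⟨u, w, h1, h2, h3, h4, h5, h6, h7⟩ := h.cut t (by omega) (fun i => i < t ∨ p < i)
      ⟨0, by omega, by omega, by omega⟩ ⟨p, by omega, by omega, by omega⟩
    rcases h5 with h5 | h5
    · rcases Nat.eq_zero_or_pos u with rfl | hu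
      · exact hzero w (by omega) h2 h7
      · exact hjump u w hu h5 (by omega) (by omega) h7
    · have := (h.out_iff u w h5 h1 (by omega) (by omega)).1 h7
      omega

end WideCrossing

/-! ### The cycle that leaves out three vertices -/

namespace ExtremalRel

variable {n b : ℕ} {R : ℕ → ℕ → Prop}

/-- A variant of `no_long_cycle` in which the cycle also runs through a list `T` of further
vertices, between the intervals `x, …, u` and `v, …, w`. -/
theorem no_long_cycle_through (h : ExtremalRel n b R) (hpath : ∀ i, i + 1 < n → R i (i + 1))
    {m e x u v w : ℕ} {T : List ℕ} (A C : List (ℕ × ℕ)) (hT : T.Nodup)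
    (hTm : ∀ t ∈ T, m ≤ t ∧ t < n) (hTch : List.IsChain R (u :: (T ++ [v])))
    (hlinkA : List.IsChain (fun s t => R s.2 t.1) ((0, e) :: (A ++ [(x, u)])))
    (hlinkC : List.IsChain (fun s t => R s.2 t.1) ((v, w) :: (C ++ [(0, 0)]))) (hm : m ≤ n)
    (hle : ∀ s ∈ (0, e) :: (A ++ (x, u) :: (v, w) :: C), s.1 ≤ s.2 ∧ s.2 < m)
    (hdisj : List.Pairwise (fun s t => s.2 < t.1 ∨ t.2 < s.1)
      ((0, e) :: (A ++ (x, u) :: (v, w) :: C)))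
    (hlen : n < (((0, e) :: (A ++ (x, u) :: (v, w) :: C)).map fun s => s.2 + 1 - s.1).sum +
      T.length + b) : False := by
  have hperm : ((0, e) :: (A ++ (x, u) :: ((T.map fun t => (t, t)) ++ (v, w) :: C))).Perm
      ((T.map fun t => (t, t)) ++ ((0, e) :: (A ++ (x, u) :: (v, w) :: C))) := by
    rw [List.perm_iff_count]
    intro a
    simp only [List.count_cons, List.count_append]
    omega
  refine h.no_long_cycle hpath e (A ++ (x, u) :: ((T.map fun t => (t, t)) ++ (v, w) :: C))
    ?_ ?_ ?_ ?_
  · have e1 : (0, e) :: (A ++ (x, u) :: ((T.map fun t => (t, t)) ++ (v, w) :: C)) ++ [(0, 0)] =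
        ((0, e) :: A) ++ (x, u) :: ((T.map fun t => (t, t)) ++ (v, w) :: (C ++ [(0, 0)])) := by
      simp
    rw [e1, List.isChain_split]
    refine ⟨hlinkA, ?_⟩
    rw [← List.cons_append, List.isChain_split]
    refine ⟨?_, hlinkC⟩
    cases T with
    | nil =>
      simp only [List.nil_append, List.map_nil, List.cons_append, List.isChain_cons_cons,
        List.isChain_singleton, and_true] at hTch ⊢
      exact hTch
    | cons t T =>
      simp only [List.cons_append, List.isChain_cons_cons, List.map_cons] at hTch ⊢
      refine ⟨hTch.1, ?_⟩
      clear hTm hT hlen hle hdisj hlinkA hlinkC hperm e1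
      induction T generalizing t u with
      | nil =>
        simpa using hTch.2
      | cons t' T ih =>
        simp only [List.cons_append, List.isChain_cons_cons, List.map_cons] at hTch ⊢
        exact ⟨hTch.2.1, ih t' ⟨hTch.2.1, hTch.2.2⟩⟩
  · intro s hs
    rcases List.mem_append.1 (hperm.mem_iff.1 hs) with h1 | h1
    · obtain ⟨t, ht, rfl⟩ := List.mem_map.1 h1
      exact ⟨le_rfl, (hTm t ht).2⟩
    · exact ⟨(hle s h1).1, (hle s h1).2.trans_le hm⟩
  · rw [hperm.pairwise_iff (fun {s t} hst => hst.symm), List.pairwise_append]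
    refine ⟨?_, hdisj, ?_⟩
    · rw [List.pairwise_map]
      exact hT.imp fun {s t} hst => by
        simp only
        omega
    · intro s hs s' hs'
      obtain ⟨t, ht, rfl⟩ := List.mem_map.1 hs
      have h1 := hTm t ht
      have h2 := hle s' hs'
      right
      simp only
      omega
  · rw [(hperm.map _).sum_eq, List.map_append, List.sum_append, List.map_map]
    have e2 : ((fun s : ℕ × ℕ => s.2 + 1 - s.1) ∘ fun t : ℕ => (t, t)) = fun _ => 1 := by
      funext t
      simp
    rw [e2]
    simp only [List.map_const', List.sum_replicate, smul_eq_mul, mul_one]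
    omega

end ExtremalRel

/-- A wide crossing, renumbered along the cycle `0, 1, …, e` that leaves out the three vertices
`e + 1`, `e + 2`, `e + 3`. The former outer vertices are now `q + 1` and `q + 2`. They have arcs to
all vertices from `q + 3` on and arcs from `j, …, q`, but no in-neighbours other than these and each
other. -/
structure ThreeOutside (n q j e : ℕ) (R : ℕ → ℕ → Prop) : Prop extends ExtremalRel n 2 R where
  card_eq : n = e + 4
  one_le : 1 ≤ j
  le_right : j ≤ q
  right_lt : q + 3 ≤ e
  path : ∀ i, i + 1 < n → R i (i + 1)
  right_to_zero : R q 0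
  left_to_zero : R e 0
  zero_to_left : R 0 (q + 3)
  seg_to_right : R (n - 1) 1
  zero_to_right : ∀ i, 1 ≤ i → i ≤ q → R 0 i
  not_right_to_zero : ∀ i, 1 ≤ i → i < q → ¬ R i 0
  pair : ∀ i, q + 3 ≤ i → i < e → R i 0 ∨ R 0 (i + 1)
  outer_to : ∀ y i, q < y → y < q + 3 → q + 3 ≤ i → i < n → R y i
  right_to_outer : ∀ y i, q < y → y < q + 3 → j ≤ i → i ≤ q → R i y
  of_to_outer : ∀ y i, q < y → y < q + 3 → i < n → R i y → j ≤ i ∧ i < q + 3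
  not_seg_to_zero : ∀ y, e < y → y < n → ¬ R y 0
  not_zero_to_seg : ∀ y, e < y → y < n → ¬ R 0 y

theorem WideCrossing.threeOutside {n p j d : ℕ} {R : ℕ → ℕ → Prop} (h : WideCrossing n p j d R)
    (hdj : d + 4 ≤ j) : ThreeOutside n (p - d - 3) (j - d - 3) (n - 4)
      (fun i k => R (rotateTail n (d + 4) i) (rotateTail n (d + 4) k)) := by
  have hn := h.card_eq
  have hd := h.one_le_left
  have hjp := h.le_length
  have rright : ∀ i, 1 ≤ i → i + (d + 4) ≤ n → rotateTail n (d + 4) i = i + d + 3 := by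
    intro i h1 h2
    rw [rotateTail_of_le (by omega) (by omega) (by omega)]
    omega
  have rleft : ∀ i, i < n → n < i + (d + 4) → rotateTail n (d + 4) i = i + (d + 4) - n := by
    intro i h1 h2
    exact rotateTail_of_lt (by omega) (by omega) (by omega)
  refine ⟨h.toExtremalRel.rotate (by omega) (by omega), by omega, by omega, by omega, by omega,
    h.rotate_arc, ?_, ?_, ?_, ?_, ?_, ?_, ?_, ?_, ?_, ?_, ?_, ?_⟩
  · rw [rotateTail_zero, rright _ (by omega) (by omega), show p - d - 3 + d + 3 = p by omega]
    exact h.close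
  · rw [rotateTail_zero, rleft _ (by omega) (by omega), show n - 4 + (d + 4) - n = d by omega]
    exact h.to_zero
  · rw [rotateTail_zero, rleft _ (by omega) (by omega),
      show p - d - 3 + 3 + (d + 4) - n = 0 + 1 by omega]
    exact h.arc 0 (by omega)
  · rw [rleft _ (by omega) (by omega), rright _ (by omega) (by omega),
      show 1 + d + 3 = n - 1 + (d + 4) - n + 1 by omega]
    exact h.path _ (by omega)
  · intro i h1 h2
    rw [rotateTail_zero, rright _ (by omega) (by omega)]
    rcases Nat.eq_or_lt_of_le h1 with rfl | h3
    · rw [show 1 + d + 3 = d + 4 by omega]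
      exact h.from_zero
    · have := (h.pair (i + d + 2) (by omega) (by omega) (by omega)).resolve_left
        (h.not_arc_zero hdj (by omega) (by omega))
      rwa [show i + d + 3 = i + d + 2 + 1 by omega]
  · intro i h1 h2
    rw [rotateTail_zero, rright _ (by omega) (by omega)]
    exact h.not_arc_zero hdj (by omega) (by omega)
  · intro i h1 h2
    rw [rotateTail_zero, rleft _ (by omega) (by omega), rleft _ (by omega) (by omega),
      show i + 1 + (d + 4) - n = i + (d + 4) - n + 1 by omega]
    exact h.pair _ (by omega) (by omega) (by omega)
  · intro y i h1 h2 h3 h4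
    rw [rright y (by omega) (by omega), rleft i (by omega) (by omega)]
    exact h.to_one (by omega) (by omega) (by omega) (by omega)
  · intro y i h1 h2 h3 h4
    rw [rright y (by omega) (by omega), rright i (by omega) (by omega)]
    exact h.to_outer (by omega) (by omega) (by omega) (by omega)
  · intro y i h1 h2 h3
    rw [rright y (by omega) (by omega)]
    rcases Nat.eq_zero_or_pos i with rfl | h4
    · rw [rotateTail_zero]
      exact fun h5 => absurd h5 (h.not_from_zero _ (by omega) (by omega))
    by_cases h5 : i + (d + 4) ≤ n
    · rw [rright i h4 h5]
      intro h6
      by_cases h7 : i + d + 3 ≤ p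
      · have := (h.in_iff _ _ (by omega) (by omega) (by omega) h7).1 h6
        omega
      · omega
    · rw [rleft i h3 (by omega)]
      intro h6
      have := (h.in_iff _ _ (by omega) (by omega) (by omega) (by omega)).1 h6
      omega
  · intro y h1 h2
    rw [rotateTail_zero, rleft y (by omega) (by omega)]
    exact h.not_to _ (by omega) (by omega)
  · intro y h1 h2
    rw [rotateTail_zero, rleft y (by omega) (by omega)]
    exact h.not_from _ (by omega) (by omega)

namespace ThreeOutside

variable {n q j e : ℕ} {R : ℕ → ℕ → Prop}

theorem arith (h : ThreeOutside n q j e R) : n = e + 4 ∧ 1 ≤ j ∧ j ≤ q ∧ q + 3 ≤ e :=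
  ⟨h.card_eq, h.one_le, h.le_right, h.right_lt⟩

/-- None of the three outside vertices can be inserted into the cycle, except between `q + 2` and
`q + 3`: otherwise exactly the two vertices `q + 1` and `q + 2` would remain between
`q → 0 → q + 3`. -/
theorem not_insertable (h : ThreeOutside n q j e R) {y a : ℕ} (hey : e < y) (hyn : y < n)
    (hae : a < e) (haq : a ≠ q + 2) : ¬ (R a y ∧ R y (a + 1)) := by
  rintro ⟨h1, h2⟩
  obtain ⟨hn, h1j, hjq, hqe⟩ := h.arith
  have ha0 : a ≠ 0 := by
    rintro rfl
    exact h.not_zero_to_seg y hey hyn h1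
  have ha1 : a < q ∨ q + 3 ≤ a := by
    by_contra hcon
    have := h.of_to_outer (a + 1) y (by omega) (by omega) hyn h2
    omega
  obtain ⟨t, ht⟩ := (h.toExtremalRel.insert_longCycle hn (fun i hi => h.path i (by omega))
    h.left_to_zero hey hyn hae h1 h2).exists_attached
  have i0 : insertAfter a y 0 = 0 := by unfold insertAfter; split_ifs <;> omega
  rcases ha1 with ha1 | ha1
  · have i1 : insertAfter a y (q + 1) = q := by unfold insertAfter; split_ifs <;> omega
    have i2 : insertAfter a y (q + 4) = q + 3 := by unfold insertAfter; split_ifs <;> omega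
    refine ht.gap_ne (d := q + 1) (c := q + 4) (by omega) (by omega) ?_ ?_ (by omega)
    · rw [i0, i1]
      exact h.right_to_zero
    · rw [i0, i2]
      exact h.zero_to_left
  · have i1 : insertAfter a y q = q := by unfold insertAfter; split_ifs <;> omega
    have i2 : insertAfter a y (q + 3) = q + 3 := by unfold insertAfter; split_ifs <;> omega
    refine ht.gap_ne (d := q) (c := q + 3) (by omega) (by omega) ?_ ?_ (by omega)
    · rw [i0, i1]
      exact h.right_to_zero
    · rw [i0, i2]
      exact h.zero_to_left

/-- The outside vertices cannot be inserted between `q + 2` and `q + 3`, either. -/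
theorem not_seg_to_left (h : ThreeOutside n q j e R) {y : ℕ} (hey : e < y) (hyn : y < n) :
    ¬ R y (q + 3) := by
  intro h2
  obtain ⟨hn, h1j, hjq, hqe⟩ := h.arith
  obtain ⟨t, ht⟩ := (h.toExtremalRel.insert_longCycle hn (fun i hi => h.path i (by omega))
    h.left_to_zero hey hyn (a := q + 2) (by omega)
    (h.outer_to _ _ (by omega) (by omega) (by omega) hyn) h2).exists_attached
  have ht1 := ht.one_le
  have i0 : ∀ i, i ≤ q + 2 → insertAfter (q + 2) y i = i := by
    intro i hi; unfold insertAfter; split_ifs <;> omega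
  have i1 : insertAfter (q + 2) y (q + 3) = y := by unfold insertAfter; split_ifs <;> omega
  -- the threshold `t` of the two remaining vertices precedes `q + 1`
  have htq : t ≤ q := by
    by_contra hcon
    have h3 := (ht.out_iff (n - 1) (q + 1) (by omega) (by omega) (by omega) (by omega)).2 (by omega)
    rw [i0 (q + 1) (by omega)] at h3
    have i4 : e < insertAfter (q + 2) y (n - 1) ∧ insertAfter (q + 2) y (n - 1) < n := by
      unfold insertAfter; split_ifs <;> omega
    have := h.of_to_outer _ _ (by omega) (by omega) i4.2 h3
    omega
  have hny : ∀ o, e + 1 < o → o < n → ¬ R (insertAfter (q + 2) y o) y := by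
    intro o h3 h4 h5
    have := (ht.out_iff o (q + 3) (by omega) (by omega) (by omega) (by omega)).1 (by rwa [i1])
    omega
  obtain rfl : y = e + 1 := by
    by_contra hne
    have h3 := h.path (y - 1) (by omega)
    rw [show y - 1 + 1 = y by omega] at h3
    refine hny y (by omega) hyn ?_
    have : insertAfter (q + 2) y y = y - 1 := by unfold insertAfter; split_ifs <;> omega
    rwa [this]
  have i2 : ∀ i, q + 4 ≤ i → i ≤ e + 1 → insertAfter (q + 2) (e + 1) i = i - 1 := by
    intro i hi hi'; unfold insertAfter; split_ifs <;> omega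
  have i3 : ∀ i, e + 2 ≤ i → insertAfter (q + 2) (e + 1) i = i := by
    intro i hi; unfold insertAfter; split_ifs <;> omega
  have hout : ∀ o i, e + 1 < o → o < n → 1 ≤ i → i ≤ q → (R o i ↔ i ≤ t) := by
    intro o i h1 h2 h3 h4
    have := ht.out_iff o i (by omega) h2 h3 (by omega)
    rwa [i3 o (by omega), i0 i (by omega)] at this
  have hin : ∀ o i, e + 1 < o → o < n → 1 ≤ i → i ≤ q → (R i o ↔ t ≤ i) := by
    intro o i h1 h2 h3 h4
    have := ht.in_iff o i (by omega) h2 h3 (by omega)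
    rwa [i3 o (by omega), i0 i (by omega)] at this
  have hleft : ∀ o i, e + 1 < o → o < n → q + 3 ≤ i → i ≤ e → ¬ R o i := by
    intro o i h1 h2 h3 h4 h5
    have := (ht.out_iff o (i + 1) (by omega) h2 (by omega) (by omega)).1 (by
      rwa [i3 o (by omega), i2 _ (by omega) (by omega), show i + 1 - 1 = i by omega])
    omega
  have hleft' : ∀ o i, e + 1 < o → o < n → q + 3 ≤ i → i ≤ e → R i o := by
    intro o i h1 h2 h3 h4
    have := (ht.in_iff o (i + 1) (by omega) h2 (by omega) (by omega)).2 (by omega)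
    rwa [i3 o (by omega), i2 _ (by omega) (by omega), show i + 1 - 1 = i by omega] at this
  have htj : t ≤ j := by
    by_contra hcon
    refine h.no_long_cycle h.path j [(q + 1, n - 1), (j + 1, q)]
      (.cons_cons (h.right_to_outer _ _ (by omega) (by omega) le_rfl hjq)
      (.cons_cons ((hout _ _ (by omega) (by omega) (by omega) (by omega)).2 (by omega))
      (.cons_cons h.right_to_zero (.singleton _)))) ?_ ?_ ?_
    · simp; omega
    · simp; omega
    · simp; omega
  -- deletion of `t` would separate `1, …, t - 1` and the two remaining vertices from the rest
  obtain ⟨u, w, w1, w2, w3, w4, w5, w6, w7⟩ := h.cut t (by omega)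
    (fun i => 1 ≤ i ∧ i < t ∨ e + 1 < i) ⟨n - 1, by omega, by omega, by omega⟩
    ⟨0, by omega, by omega, by omega⟩
  have hw : w ≤ q ∨ q + 3 ≤ w := by
    by_contra hcon
    have := h.of_to_outer w u (by omega) (by omega) w1 w7
    omega
  rcases w5 with w5 | w5
  · have h0 : R 0 (u + 1) := h.zero_to_right _ (by omega) (by omega)
    rcases Nat.eq_zero_or_pos w with rfl | hw0
    · exact h.not_right_to_zero u w5.1 (by omega) w7
    by_cases hwq : w ≤ q
    · refine h.no_long_cycle h.path 0
        [(u + 1, w - 1), (n - 2, n - 1), (1, u), (w, q + 2), (e + 1, e + 1), (q + 3, e)]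
        (.cons_cons h0
        (.cons_cons ((hin _ _ (by omega) (by omega) (by omega) (by omega)).2 (by omega))
        (.cons_cons ((hout _ _ (by omega) (by omega) (by omega) (by omega)).2 (by omega))
        (.cons_cons w7
        (.cons_cons (h.outer_to _ _ (by omega) (by omega) (by omega) (by omega))
        (.cons_cons h2 (.cons_cons h.left_to_zero (.singleton _)))))))) ?_ ?_ ?_
      · simp; omega
      · simp; omega
      · simp; omega
    by_cases hwe : w = e + 1
    · subst hwe
      refine h.no_long_cycle h.path 0
        [(u + 1, q + 2), (n - 2, n - 1), (1, u), (e + 1, e + 1), (q + 3, e)]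
        (.cons_cons h0
        (.cons_cons (h.outer_to _ _ (by omega) (by omega) (by omega) (by omega))
        (.cons_cons ((hout _ _ (by omega) (by omega) (by omega) (by omega)).2 (by omega))
        (.cons_cons w7 (.cons_cons h2 (.cons_cons h.left_to_zero (.singleton _))))))) ?_ ?_ ?_
      · simp; omega
      · simp; omega
      · simp; omega
    by_cases hwq3 : w = q + 3
    · subst hwq3
      refine h.no_long_cycle h.path 0
        [(u + 1, q + 2), (e + 1, n - 1), (1, u), (q + 3, e)]
        (.cons_cons h0
        (.cons_cons (h.outer_to _ _ (by omega) (by omega) (by omega) (by omega))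
        (.cons_cons ((hout _ _ (by omega) (by omega) (by omega) (by omega)).2 (by omega))
        (.cons_cons w7 (.cons_cons h.left_to_zero (.singleton _)))))) ?_ ?_ ?_
      · simp; omega
      · simp; omega
      · simp; omega
    · refine h.no_long_cycle h.path 0
        [(u + 1, q + 2), (e + 1, e + 1), (q + 3, w - 1), (n - 2, n - 1), (1, u), (w, e)]
        (.cons_cons h0
        (.cons_cons (h.outer_to _ _ (by omega) (by omega) (by omega) (by omega))
        (.cons_cons h2
        (.cons_cons (hleft' _ _ (by omega) (by omega) (by omega) (by omega))
        (.cons_cons ((hout _ _ (by omega) (by omega) (by omega) (by omega)).2 (by omega))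
        (.cons_cons w7 (.cons_cons h.left_to_zero (.singleton _)))))))) ?_ ?_ ?_
      · simp; omega
      · simp; omega
      · simp; omega
  · rcases Nat.eq_zero_or_pos w with rfl | hw0
    · exact h.not_seg_to_zero u (by omega) w1 w7
    by_cases hwq : w ≤ q
    · have := (hout u w w5 w1 hw0 hwq).1 w7
      omega
    by_cases hwe : w = e + 1
    · subst hwe
      exact hny u w5 w1 (by rwa [i3 u (by omega)])
    · exact hleft u w w5 w1 (by omega) (by omega) w7

end ThreeOutside

/-! ### Paths through the three outside vertices -/

/-- There is a path from `u` to `v` whose inner vertices are at least `m` of the three vertices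
`e + 1`, `e + 2`, `e + 3`. -/
def Bridge (R : ℕ → ℕ → Prop) (e m u v : ℕ) : Prop :=
  ∃ T : List ℕ, T.Nodup ∧ (∀ t ∈ T, e + 1 ≤ t ∧ t < e + 4) ∧ List.IsChain R (u :: (T ++ [v])) ∧
    m ≤ T.length

theorem bridge_two {R : ℕ → ℕ → Prop} {e u v y y' : ℕ} (hy : e < y) (hy4 : y < e + 4)
    (hy' : e < y') (hy4' : y' < e + 4) (hne : y ≠ y') (h1 : R u y) (h2 : R y y') (h3 : R y' v) :
    Bridge R e 2 u v :=
  ⟨[y, y'], by simpa using hne, by simp; omega,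
    .cons_cons h1 (.cons_cons h2 (.cons_cons h3 (.singleton _))), le_rfl⟩

theorem bridge_three {R : ℕ → ℕ → Prop} {e u v y x y' : ℕ} (hy : e < y) (hy4 : y < e + 4)
    (hx : e < x) (hx4 : x < e + 4) (hy' : e < y') (hy4' : y' < e + 4) (hyx : y ≠ x) (hxy' : x ≠ y')
    (hyy' : y ≠ y') (h1 : R u y) (h2 : R y x) (h3 : R x y') (h4 : R y' v) : Bridge R e 3 u v :=
  ⟨[y, x, y'], by simp; omega, by simp; omega,
    .cons_cons h1 (.cons_cons h2 (.cons_cons h3 (.cons_cons h4 (.singleton _)))), le_rfl⟩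

theorem Bridge.mono {R : ℕ → ℕ → Prop} {e m m' u v : ℕ} (h : Bridge R e m u v) (hm : m' ≤ m) :
    Bridge R e m' u v := by
  obtain ⟨T, h1, h2, h3, h4⟩ := h
  exact ⟨T, h1, h2, h3, hm.trans h4⟩

/-- At the place `i`, an arc of the cycle `0, 1, …, e` or a vertex off it, the vertex `y` has fewer
arcs than it could have if it cannot be inserted into the cycle. -/
def Defect (n e : ℕ) (R : ℕ → ℕ → Prop) (y i : ℕ) : Prop :=
  i < n ∧ ((i < e ∧ ¬ R i y ∧ ¬ R y (i + 1)) ∨ (i = e ∧ ¬ R e y ∧ ¬ R y 0) ∨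
    (e < i ∧ i ≠ y ∧ ¬ (R y i ∧ R i y)))

namespace ThreeOutside

variable {n q j e : ℕ} {R : ℕ → ℕ → Prop}

theorem not_insert (h : ThreeOutside n q j e R) {y a : ℕ} (hey : e < y) (hyn : y < n)
    (hae : a < e) : ¬ (R a y ∧ R y (a + 1)) := by
  by_cases haq : a = q + 2
  · subst haq
    exact fun h1 => h.not_seg_to_left hey hyn h1.2
  · exact h.not_insertable hey hyn hae haq

/-- By the degree condition, an outside vertex has at most one defect. -/
theorem defect_unique (h : ThreeOutside n q j e R) {y i k : ℕ} (hey : e < y) (hyn : y < n)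
    (hi : Defect n e R y i) (hk : Defect n e R y k) : i = k := by
  by_contra hik
  have h1 := relDegree_add_card_le hey hyn (h.irrefl y)
    (fun a ha => h.not_insert hey hyn ha) (fun h2 => h.not_seg_to_zero y hey hyn h2.2) {i, k} (by
      intro x hx
      simp only [Finset.mem_insert, Finset.mem_singleton] at hx
      rcases hx with rfl | rfl
      · exact hi
      · exact hk)
  rw [Finset.card_pair hik] at h1
  have h2 := h.degree y (by omega) hyn
  have h3 := h.card_eq
  omega

theorem exists_third {e y y' : ℕ} (hey : e < y) (hyn : y < e + 4) (hey' : e < y')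
    (hyn' : y' < e + 4)
    (hne : y ≠ y') : ∃ x, e < x ∧ x < e + 4 ∧ x ≠ y ∧ x ≠ y' :=
  ⟨3 * e + 6 - y - y', by omega, by omega, by omega, by omega⟩

theorem defect_seg {y i : ℕ} (hei : e < i) (hin : i < n) (hiy : i ≠ y)
    (hyi : ¬ (R y i ∧ R i y)) : Defect n e R y i :=
  ⟨hin, Or.inr (Or.inr ⟨hei, hiy, hyi⟩)⟩

/-- Two outside vertices are joined by an arc, or through the third one. -/
theorem arc_or_path (h : ThreeOutside n q j e R) {y y' x : ℕ} (hey : e < y) (hyn : y < n)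
    (hey' : e < y') (hyn' : y' < n) (hex : e < x) (hxn : x < n) (hne : y ≠ y') (hxy : x ≠ y)
    (hxy' : x ≠ y') (hyy' : ¬ R y y') : R y x ∧ R x y' := by
  have h1 := defect_seg (y := y) hey' hyn' hne.symm (fun h1 => hyy' h1.1)
  have h2 := defect_seg (y := y') hey hyn hne (fun h1 => hyy' h1.2)
  constructor
  · by_contra h3
    exact hxy' (h.defect_unique hey hyn (defect_seg hex hxn hxy fun h4 => h3 h4.1) h1)
  · by_contra h3
    exact hxy (h.defect_unique hey' hyn' (defect_seg hex hxn hxy' fun h4 => h3 h4.2) h2)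

theorem bridge_of_ne (h : ThreeOutside n q j e R) {y y' u v : ℕ} (hey : e < y) (hyn : y < n)
    (hey' : e < y') (hyn' : y' < n) (hne : y ≠ y') (huy : R u y) (hyv : R y' v) :
    Bridge R e 2 u v := by
  have hn := h.card_eq
  subst hn
  by_cases hyy' : R y y'
  · exact bridge_two hey hyn hey' hyn' hne huy hyy' hyv
  · obtain ⟨x, h1, h2, h3, h4⟩ := exists_third hey hyn hey' hyn' hne
    have h5 := h.arc_or_path hey hyn hey' hyn' h1 h2 hne h3 h4 hyy'
    exact (bridge_three hey hyn h1 h2 hey' hyn' h3.symm h4 hne huy h5.1 h5.2 hyv).mono (by omega)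

/-- Two vertices of the cycle that are consecutive are not joined through the outside vertices. -/
theorem not_in_out (h : ThreeOutside n q j e R) {y y' u : ℕ} (hey : e < y) (hyn : y < n)
    (hey' : e < y') (hyn' : y' < n) (hue : u < e) : ¬ (R u y ∧ R y' (u + 1)) := by
  rintro ⟨h1, h2⟩
  obtain ⟨hn, h1j, hjq, hqe⟩ := h.arith
  rcases eq_or_ne y y' with rfl | hne
  · exact h.not_insert hey hyn hue ⟨h1, h2⟩
  rcases Nat.eq_zero_or_pos u with rfl | hu
  · exact h.not_zero_to_seg y hey hyn h1
  obtain ⟨T, hT1, hT2, hT3, hT4⟩ := h.bridge_of_ne hey hyn hey' hyn' hne h1 h2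
  refine h.no_long_cycle_through h.path [] [] (e := 0) (x := 1) (w := e) (m := e + 1) hT1
    (fun t ht => ?_) hT3 (.cons_cons (h.path 0 (by omega)) (.singleton _))
    (.cons_cons h.left_to_zero (.singleton _)) (by omega) ?_ ?_ ?_
  · have := hT2 t ht
    omega
  · simp; omega
  · simp
  · simp; omega

/-- A vertex of the cycle with an arc to an outside vertex and one with an arc from an outside
vertex are joined by a path through at least two outside vertices. -/
theorem bridge (h : ThreeOutside n q j e R) {y y' u v : ℕ} (hey : e < y) (hyn : y < n)
    (hey' : e < y') (hyn' : y' < n) (hue : u ≤ e) (hv : 1 ≤ v) (hve : v ≤ e) (huy : R u y)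
    (hyv : R y' v) : Bridge R e 2 u v := by
  have hn := h.card_eq
  rcases eq_or_ne y y' with rfl | hne
  · obtain ⟨x, h1, h2, h3⟩ : ∃ x, e < x ∧ x < n ∧ x ≠ y := by
      by_cases hy1 : y = e + 1
      · exact ⟨e + 2, by omega, by omega, by omega⟩
      · exact ⟨e + 1, by omega, by omega, by omega⟩
    have huv : u ≠ v - 1 := by
      rintro rfl
      exact h.not_insert hey hyn (a := v - 1) (by omega)
        ⟨huy, by rwa [show v - 1 + 1 = v by omega]⟩
    by_cases hux : R u x
    · exact h.bridge_of_ne h1 h2 hey hyn h3 hux hyv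
    by_cases hxv : R x v
    · exact h.bridge_of_ne hey hyn h1 h2 h3.symm huy hxv
    · exfalso
      refine huv (h.defect_unique h1 h2 ⟨by omega, ?_⟩
        ⟨by omega, Or.inl ⟨by omega, fun h4 => ?_, ?_⟩⟩)
      · rcases Nat.lt_or_ge u e with h4 | h4
        · exact Or.inl ⟨h4, hux, fun h5 => h.not_in_out hey hyn h1 h2 h4 ⟨huy, h5⟩⟩
        · obtain rfl : u = e := by omega
          exact Or.inr (Or.inl ⟨rfl, hux, h.not_seg_to_zero x h1 h2⟩)
      · exact h.not_in_out h1 h2 hey hyn (u := v - 1) (by omega)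
          ⟨h4, by rwa [show v - 1 + 1 = v by omega]⟩
      · rwa [show v - 1 + 1 = v by omega]
  · exact h.bridge_of_ne hey hyn hey' hyn' hne huy hyv

/-- If all outside vertices have their only defect at the same place `k`, they form a complete
digraph. -/
theorem arc_of_defect (h : ThreeOutside n q j e R) {k y y' : ℕ} (hke : k ≤ e)
    (hk : ∀ y, e < y → y < n → Defect n e R y k) (hey : e < y) (hyn : y < n)
    (hey' : e < y') (hyn' : y' < n) (hne : y ≠ y') : R y y' := by
  by_contra h1
  have := h.defect_unique hey hyn (hk y hey hyn)
    (defect_seg hey' hyn' hne.symm fun h2 => h1 h2.1)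
  omega

theorem bridge_all (h : ThreeOutside n q j e R) {k y y' u v : ℕ} (hke : k ≤ e)
    (hk : ∀ y, e < y → y < n → Defect n e R y k)
    (hey : e < y) (hyn : y < n) (hey' : e < y') (hyn' : y' < n) (hue : u ≤ e) (hv : 1 ≤ v)
    (hve : v ≤ e) (huk : u ≠ k) (hvk : v - 1 ≠ k) (huy : R u y) (hyv : R y' v) :
    Bridge R e 3 u v := by
  have hn := h.card_eq
  have hall : ∀ x, e < x → x < n → R u x := by
    intro x h1 h2
    by_contra h3
    refine huk (h.defect_unique h1 h2 ⟨by omega, ?_⟩ (hk x h1 h2))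
    rcases Nat.lt_or_ge u e with h4 | h4
    · exact Or.inl ⟨h4, h3, fun h5 => h.not_in_out hey hyn h1 h2 h4 ⟨huy, h5⟩⟩
    · obtain rfl : u = e := by omega
      exact Or.inr (Or.inl ⟨rfl, h3, h.not_seg_to_zero x h1 h2⟩)
  have hall' : ∀ x, e < x → x < n → R x v := by
    intro x h1 h2
    by_contra h3
    refine hvk (h.defect_unique h1 h2 ⟨by omega, Or.inl ⟨by omega, fun h4 => ?_, ?_⟩⟩ (hk x h1 h2))
    · exact h.not_in_out h1 h2 hey' hyn' (u := v - 1) (by omega)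
        ⟨h4, by rwa [show v - 1 + 1 = v by omega]⟩
    · rwa [show v - 1 + 1 = v by omega]
  have harc := fun y y' => h.arc_of_defect (y := y) (y' := y') hke hk
  exact bridge_three (y := e + 1) (x := e + 2) (y' := e + 3) (by omega) (by omega) (by omega)
    (by omega) (by omega) (by omega) (by omega) (by omega) (by omega)
    (hall _ (by omega) (by omega))
    (harc _ _ (by omega) (by omega) (by omega) (by omega) (by omega))
    (harc _ _ (by omega) (by omega) (by omega) (by omega) (by omega))
    (hall' _ (by omega) (by omega))

/-- If the outside vertices are not adjacent to `i + 1` and `i + 2` and can replace both, a longest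
possible cycle results, and so `0` is not adjacent to `i + 1` and `i + 2`. -/
theorem not_replace (h : ThreeOutside n q j e R) {i : ℕ} (hqi : q + 2 ≤ i) (hie : i + 3 ≤ e)
    (hin : R i (e + 1)) (hout : R (e + 3) (i + 3)) : False := by
  obtain ⟨hn, h1j, hjq, hqe⟩ := h.arith
  set σ : ℕ → ℕ := fun k => if k ≤ i then k else if k ≤ i + 3 then k - (i + 1) + (e + 1)
    else if k ≤ e + 1 then k - 1 else if k = e + 2 then i + 1 else if k = e + 3 then i + 2 else k
    with hσ
  have hrel := h.toExtremalRel.comp σ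
    (by intro k hk; simp only [hσ]; split_ifs <;> omega)
    (by intro k hk l hl; simp only [hσ]; split_ifs <;> omega) (by simp [hσ])
  have s1 : ∀ k, k ≤ i → σ k = k := by intro k hk; simp only [hσ]; split_ifs <;> omega
  have s2 : ∀ k, i < k → k ≤ i + 3 → σ k = k - (i + 1) + (e + 1) := by
    intro k hk hk'; simp only [hσ]; split_ifs <;> omega
  have s3 : ∀ k, i + 3 < k → k ≤ e + 1 → σ k = k - 1 := by
    intro k hk hk'; simp only [hσ]; split_ifs <;> omega
  have s4 : σ (e + 2) = i + 1 := by simp only [hσ]; split_ifs <;> omega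
  have s5 : σ (e + 3) = i + 2 := by simp only [hσ]; split_ifs <;> omega
  have hlong : LongCycle n 2 (e + 1) (fun k l => R (σ k) (σ l)) := by
    refine ⟨hrel, by omega, fun k hk => ?_, ?_⟩
    · by_cases h1 : k + 1 ≤ i
      · rw [s1 k (by omega), s1 (k + 1) h1]
        exact h.path k (by omega)
      by_cases h2 : k = i
      · rw [s1 k (by omega), s2 (k + 1) (by omega) (by omega), h2,
          show i + 1 - (i + 1) + (e + 1) = e + 1 by omega]
        exact hin
      by_cases h3 : k + 1 ≤ i + 3
      · rw [s2 k (by omega) (by omega), s2 (k + 1) (by omega) (by omega),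
          show k + 1 - (i + 1) + (e + 1) = k - (i + 1) + (e + 1) + 1 by omega]
        exact h.path _ (by omega)
      by_cases h4 : k = i + 3
      · rw [s2 k (by omega) (by omega), s3 (k + 1) (by omega) (by omega), h4,
          show i + 3 - (i + 1) + (e + 1) = e + 3 by omega, show i + 3 + 1 - 1 = i + 3 by omega]
        exact hout
      · rw [s3 k (by omega) (by omega), s3 (k + 1) (by omega) (by omega),
          show k + 1 - 1 = k - 1 + 1 by omega]
        exact h.path _ (by omega)
    · rw [s1 0 (by omega)]
      by_cases h1 : i + 3 < e + 1
      · rw [s3 _ h1 le_rfl]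
        exact h.left_to_zero
      · omega
  obtain ⟨t, ht⟩ := hlong.exists_attached
  rcases h.pair (i + 1) (by omega) (by omega) with h1 | h1
  · exact ht.not_to_zero (e + 2) (by omega) (by omega) (by rwa [s4, s1 0 (by omega)])
  · exact ht.not_from_zero (e + 3) (by omega) (by omega) (by rwa [s5, s1 0 (by omega)])

/-- The outside vertices have no arcs to `q + 3, …, e`. -/
theorem not_seg_to (h : ThreeOutside n q j e R) {y i : ℕ} (hey : e < y) (hyn : y < n)
    (hqi : q < i) (hie : i ≤ e) : ¬ R y i := by
  classical
  obtain ⟨hn, h1j, hjq, hqe⟩ := h.arith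
  by_cases hqi3 : i < q + 3
  · intro h1
    have := h.of_to_outer i y hqi hqi3 hyn h1
    omega
  intro hyi
  have hex : ∃ i, q + 3 ≤ i ∧ i ≤ e ∧ ∃ y, e < y ∧ y < n ∧ R y i :=
    ⟨i, by omega, hie, y, hey, hyn, hyi⟩
  obtain ⟨h1, h2, z, hez, hzn, hz⟩ := Nat.find_spec hex
  have hmin : ∀ k, q + 3 ≤ k → k < Nat.find hex → ∀ y, e < y → y < n → ¬ R y k :=
    fun k h3 h4 y h5 h6 h7 => Nat.find_min hex h4 ⟨h3, by omega, y, h5, h6, h7⟩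
  set s := Nat.find hex
  have hs : q + 4 ≤ s := by
    by_contra hs
    exact h.not_seg_to_left hez hzn (by rwa [show q + 3 = s by omega])
  obtain ⟨i, hi⟩ : ∃ i, s = i + 2 := ⟨s - 2, by omega⟩
  rw [hi] at hs h2 hz hmin
  have hin1 : ∀ y, e < y → y < n → ¬ R (i + 1) y := fun y h3 h4 h5 =>
    h.not_in_out h3 h4 hez hzn (by omega) ⟨h5, hz⟩
  have hout1 : ∀ y, e < y → y < n → ¬ R y (i + 1) := hmin (i + 1) (by omega) (by omega)
  have hdef : ∀ y, e < y → y < n → ¬ R i y → Defect n e R y i := fun y h3 h4 h5 =>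
    ⟨by omega, Or.inl ⟨by omega, h5, hout1 y h3 h4⟩⟩
  have hdef1 : ∀ y, e < y → y < n → ¬ R y (i + 2) → Defect n e R y (i + 1) := fun y h3 h4 h5 =>
    ⟨by omega, Or.inl ⟨by omega, hin1 y h3 h4, h5⟩⟩
  by_cases hin : ∃ y, e < y ∧ y < n ∧ R i y
  · obtain ⟨y, h3, h4, h5⟩ := hin
    -- all three outside vertices together would replace `i + 1`
    have hbridge : Bridge R e 3 i (i + 2) := by
      subst hn
      by_cases hcompl : ∃ a b, e < a ∧ a < e + 4 ∧ e < b ∧ b < e + 4 ∧ a ≠ b ∧ ¬ R a b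
      · obtain ⟨a, b, ha, ha', hb, hb', hab, hRab⟩ := hcompl
        obtain ⟨x, hx, hx', hxa, hxb⟩ := exists_third ha ha' hb hb' hab
        have h6 := h.arc_or_path ha ha' hb hb' hx hx' hab hxa hxb hRab
        have h7 : R i a := by
          by_contra h7
          have := h.defect_unique ha ha' (hdef a ha ha' h7)
            (defect_seg hb hb' hab.symm fun h8 => hRab h8.1)
          omega
        have h8 : R b (i + 2) := by
          by_contra h8
          have := h.defect_unique hb hb' (hdef1 b hb hb' h8)
            (defect_seg ha ha' hab fun h8 => hRab h8.2)
          omega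
        exact bridge_three ha ha' hx hx' hb hb' hxa.symm hxb hab h7 h6.1 h6.2 h8
      · have harc : ∀ a b, e < a → a < e + 4 → e < b → b < e + 4 → a ≠ b → R a b := by
          intro a b ha ha' hb hb' hab
          by_contra hRab
          exact hcompl ⟨a, b, ha, ha', hb, hb', hab, hRab⟩
        have hthree : ∀ a b, e < a → a < e + 4 → e < b → b < e + 4 → a ≠ b → R i a →
            R b (i + 2) → Bridge R e 3 i (i + 2) := by
          intro a b ha ha' hb hb' hab h6 h7
          obtain ⟨x, hx, hx', hxa, hxb⟩ := exists_third ha ha' hb hb' hab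
          exact bridge_three ha ha' hx hx' hb hb' hxa.symm hxb hab h6
            (harc _ _ ha ha' hx hx' hxa.symm) (harc _ _ hx hx' hb hb' hxb) h7
        rcases eq_or_ne y z with rfl | hyz
        · obtain ⟨x, hx, hx', hxy⟩ : ∃ x, e < x ∧ x < e + 4 ∧ x ≠ y := by
            by_cases hy1 : y = e + 1
            · exact ⟨e + 2, by omega, by omega, by omega⟩
            · exact ⟨e + 1, by omega, by omega, by omega⟩
          by_cases h6 : R i x
          · exact hthree x y hx hx' hez hzn hxy h6 hz
          by_cases h7 : R x (i + 2)
          · exact hthree y x hez hzn hx hx' hxy.symm h5 h7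
          · have := h.defect_unique hx hx' (hdef x hx hx' h6) (hdef1 x hx hx' h7)
            omega
        · exact hthree y z h3 h4 hez hzn hyz h5 hz
    obtain ⟨T, hT1, hT2, hT3, hT4⟩ := hbridge
    refine h.no_long_cycle_through h.path [] [] (e := 0) (x := 1) (w := e) (m := e + 1) hT1
      (fun t ht => ?_) hT3 (.cons_cons (h.path 0 (by omega)) (.singleton _))
      (.cons_cons h.left_to_zero (.singleton _)) (by omega) ?_ ?_ ?_
    · have := hT2 t ht
      omega
    · simp; omega
    · simp
    · simp; omega
  · -- the outside vertices would have to be attached around `i` and `i + 1`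
    have hin0 : ∀ y, e < y → y < n → ¬ R i y := fun y h3 h4 h5 => hin ⟨y, h3, h4, h5⟩
    have hiq : q + 3 ≤ i := by
      by_contra hiq
      exact hin0 (e + 1) (by omega) (by omega)
        (h.outer_to i (e + 1) (by omega) (by omega) (by omega) (by omega))
    obtain ⟨l, rfl⟩ : ∃ l, i = l + 1 := ⟨i - 1, by omega⟩
    refine h.not_replace (i := l) (by omega) (by omega) ?_ ?_
    · by_contra h3
      have := h.defect_unique (y := e + 1) (by omega) (by omega)
        (hdef (e + 1) (by omega) (by omega) (hin0 _ (by omega) (by omega)))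
        (k := l) ⟨by omega, Or.inl ⟨by omega, h3, hmin _ (by omega) (by omega) _ (by omega)
          (by omega)⟩⟩
      omega
    · by_contra h3
      have := h.defect_unique (y := e + 3) (by omega) (by omega)
        (hdef (e + 3) (by omega) (by omega) (hin0 _ (by omega) (by omega)))
        (hdef1 (e + 3) (by omega) (by omega) h3)
      omega

theorem contradiction (h : ThreeOutside n q j e R) : False := by
  classical
  obtain ⟨hn, h1j, hjq, hqe⟩ := h.arith
  -- `t` is the last vertex on the cycle with an arc from an outside vertex
  obtain ⟨t, ht1, htq, ⟨z, hez, hzn, hz⟩, htmax⟩ : ∃ t, 1 ≤ t ∧ t ≤ q ∧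
      (∃ y, e < y ∧ y < n ∧ R y t) ∧ ∀ i, t < i → i ≤ e → ∀ y, e < y → y < n → ¬ R y i := by
    set P : ℕ → Prop := fun i => ∃ y, e < y ∧ y < n ∧ R y i with hP
    have hP1 : P 1 := ⟨n - 1, by omega, by omega, h.seg_to_right⟩
    refine ⟨Nat.findGreatest P q, Nat.le_findGreatest (by omega) hP1, Nat.findGreatest_le q,
      Nat.findGreatest_spec (P := P) (m := 1) (by omega) hP1, ?_⟩
    intro i hi hie y hey hyn hyi
    by_cases hiq : i ≤ q
    · exact Nat.findGreatest_is_greatest hi hiq ⟨y, hey, hyn, hyi⟩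
    · exact h.not_seg_to hey hyn (by omega) hie hyi
  have hlast : R e (e + 1) := h.path e (by omega)
  have htj : t ≤ j := by
    by_contra hcon
    obtain ⟨T, hT1, hT2, hT3, hT4⟩ := h.bridge (y := e + 1) (u := e) (by omega) (by omega) hez hzn
      le_rfl ht1 (by omega) hlast hz
    refine h.no_long_cycle_through h.path [] [] (e := t - 1) (x := q + 1) (w := q) (m := e + 1) hT1
      (fun t ht => ?_) hT3
      (.cons_cons (h.right_to_outer _ _ (by omega) (by omega) (by omega) (by omega)) (.singleton _))
      (.cons_cons h.right_to_zero (.singleton _)) (by omega) ?_ ?_ ?_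
    · have := hT2 t ht
      omega
    · simp; omega
    · simp; omega
    · simp; omega
  -- from `t` on, at most one vertex of the cycle has no arc to the outside vertices
  have hhole : ∀ k, t ≤ k → k ≤ e → (¬ ∃ y, e < y ∧ y < n ∧ R k y) →
      ∀ y, e < y → y < n → Defect n e R y k := by
    intro k h1 h2 h3 y h4 h5
    refine ⟨by omega, ?_⟩
    rcases Nat.lt_or_ge k e with h6 | h6
    · exact Or.inl ⟨h6, fun h7 => h3 ⟨y, h4, h5, h7⟩, htmax (k + 1) (by omega) (by omega) y h4 h5⟩
    · obtain rfl : k = e := by omega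
      exact Or.inr (Or.inl ⟨rfl, fun h7 => h3 ⟨y, h4, h5, h7⟩, h.not_seg_to_zero y h4 h5⟩)
  have hhole1 : ∀ k l, t ≤ k → k ≤ e → t ≤ l → l ≤ e → k ≠ l →
      (∃ y, e < y ∧ y < n ∧ R k y) ∨ ∃ y, e < y ∧ y < n ∧ R l y := by
    intro k l h1 h2 h3 h4 h5
    by_contra h6
    push Not at h6
    exact h5 (h.defect_unique (y := e + 1) (by omega) (by omega)
      (hhole k h1 h2 (fun ⟨y, h7, h8, h9⟩ => h6.1 y h7 h8 h9) _ (by omega) (by omega))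
      (hhole l h3 h4 (fun ⟨y, h7, h8, h9⟩ => h6.2 y h7 h8 h9) _ (by omega) (by omega)))
  obtain ⟨s, hts, hsj, hst, hs⟩ : ∃ s, t ≤ s ∧ s ≤ j ∧ s ≤ t + 1 ∧
      (s = j ∨ ∃ y, e < y ∧ y < n ∧ R s y) := by
    by_cases h1 : t = j
    · exact ⟨t, le_rfl, htj, by omega, Or.inl h1⟩
    rcases hhole1 t (t + 1) le_rfl (by omega) (by omega) (by omega) (by omega) with h2 | h2
    · exact ⟨t, le_rfl, htj, by omega, Or.inr h2⟩
    · exact ⟨t + 1, by omega, by omega, by omega, Or.inr h2⟩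
  -- deletion of `s` would separate `1, …, s - 1` and the outside vertices from the rest
  obtain ⟨u, w, w1, w2, w3, w4, w5, w6, w7⟩ := h.cut s (by omega)
    (fun i => 1 ≤ i ∧ i < s ∨ e < i) ⟨n - 1, by omega, by omega, by omega⟩
    ⟨0, by omega, by omega, by omega⟩
  rcases w5 with w5 | w5
  · have h0 : R 0 (u + 1) := h.zero_to_right _ (by omega) (by omega)
    rcases Nat.eq_zero_or_pos w with rfl | hw0
    · exact h.not_right_to_zero u w5.1 (by omega) w7
    have hwo : w ≤ q ∨ q + 3 ≤ w := by
      by_contra hwo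
      have := h.of_to_outer w u (by omega) (by omega) w1 w7
      omega
    have hseg1 : R (e + 3) 1 := by
      have := h.seg_to_right
      rwa [show n - 1 = e + 3 by omega] at this
    by_cases hwj : w ≤ q ∧ j < w
    · obtain ⟨T, hT1, hT2, hT3, hT4⟩ := h.bridge (y := e + 1) (y' := e + 3) (u := e) (v := 1)
        (by omega) (by omega) (by omega) (by omega) le_rfl le_rfl (by omega) hlast hseg1
      refine h.no_long_cycle_through h.path [(u + 1, w - 1)] [(w, q)] (e := 0) (x := q + 1)
        (w := u) (m := e + 1) hT1 (fun t ht => ?_) hT3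
        (.cons_cons h0 (.cons_cons (h.right_to_outer _ _ (by omega) (by omega) (by omega)
          (by omega)) (.singleton _)))
        (.cons_cons w7 (.cons_cons h.right_to_zero (.singleton _))) (by omega) ?_ ?_ ?_
      · have := hT2 t ht
        omega
      · simp; omega
      · simp; omega
      · simp; omega
    by_cases hin : ∃ y, e < y ∧ y < n ∧ R (w - 1) y
    · obtain ⟨y, h1, h2, h3⟩ := hin
      obtain ⟨T, hT1, hT2, hT3, hT4⟩ := h.bridge (y := y) (y' := e + 3) (u := w - 1) (v := 1)
        h1 h2 (by omega) (by omega) (by omega) le_rfl (by omega) h3 hseg1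
      refine h.no_long_cycle_through h.path [] [(w, e)] (e := 0) (x := u + 1)
        (w := u) (m := e + 1) hT1 (fun t ht => ?_) hT3 (.cons_cons h0 (.singleton _))
        (.cons_cons w7 (.cons_cons h.left_to_zero (.singleton _))) (by omega) ?_ ?_ ?_
      · have := hT2 t ht
        omega
      · simp; omega
      · simp; omega
      · simp; omega
    · have hws : s < w - 1 := by
        rcases Nat.lt_or_ge s (w - 1) with h1 | h1
        · exact h1
        · have h2 : s = w - 1 := by omega
          rcases hs with h3 | h3
          · omega
          · rw [h2] at h3
            exact absurd h3 hin
      obtain ⟨y, h1, h2, h3⟩ := (hhole1 (w - 2) (w - 1) (by omega) (by omega) (by omega) (by omega)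
        (by omega)).resolve_right hin
      obtain ⟨T, hT1, hT2, hT3, hT4⟩ := h.bridge_all (k := w - 1) (y := y) (y' := e + 3)
        (u := w - 2) (v := 1) (by omega) (hhole (w - 1) (by omega) (by omega) hin)
        h1 h2 (by omega) (by omega) (by omega) le_rfl (by omega) (by omega) (by omega) h3 hseg1
      refine h.no_long_cycle_through h.path [] [(w, e)] (e := 0) (x := u + 1)
        (w := u) (m := e + 1) hT1 (fun t ht => ?_) hT3 (.cons_cons h0 (.singleton _))
        (.cons_cons w7 (.cons_cons h.left_to_zero (.singleton _))) (by omega) ?_ ?_ ?_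
      · have := hT2 t ht
        omega
      · simp; omega
      · simp; omega
      · simp; omega
  · rcases Nat.eq_zero_or_pos w with rfl | hw0
    · exact h.not_seg_to_zero u w5 w1 w7
    · exact htmax w (by omega) (by omega) u w5 w1 w7

end ThreeOutside

/-- There is no longest possible cycle that is not Hamiltonian. -/
theorem LongCycle.contradiction {n b p : ℕ} {R : ℕ → ℕ → Prop} (h : LongCycle n b p R) : False := by
  obtain ⟨j, hj⟩ := h.exists_attached
  obtain ⟨rfl, d, hd⟩ := hj.exists_wideCrossing
  by_cases hdj : d < j
  · exact (hd.threeOutside (hd.threshold_not_between hdj)).contradiction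
  · have h1 := hd.right_le
    exact (hd.reverse.threeOutside (by omega)).contradiction

/-! ### From digraphs to relations -/

theorem exists_rel_of_isChain {α : Type*} {r : α → α → Prop} {P : α → Prop} :
    ∀ {l : List α} {a b : α}, List.IsChain r l → l.head? = some a → l.getLast? = some b → P a →
      ¬ P b → ∃ x y, r x y ∧ P x ∧ ¬ P y
  | [], _, _, _, h1, _, _, _ => by simp at h1
  | [x], a, b, _, h1, h2, ha, hb => by
    simp only [List.head?_cons, Option.some.injEq, List.getLast?_singleton] at h1 h2
    subst h1 h2
    exact absurd ha hb
  | x :: y :: l, a, b, hch, h1, h2, ha, hb => by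
    rw [List.isChain_cons_cons] at hch
    simp only [List.head?_cons, Option.some.injEq] at h1
    subst h1
    by_cases hy : P y
    · exact exists_rel_of_isChain hch.2 rfl (by simpa using h2) hy hb
    · exact ⟨x, y, hch.1, ha, hy⟩

namespace Digraph

variable {V : Type*} [Fintype V] {D : Digraph V}

theorem IsCycle.length_le {c : Cycle V} (hc : D.IsCycle c) : c.length ≤ Fintype.card V := by
  induction c using Quotient.inductionOn with
  | h l => exact List.Nodup.length_le_card (Cycle.nodup_coe_iff.1 hc.nodup)

/-- The cycle is listed from `z` on. -/
theorem exists_cons_of_mem {α : Type*} {c : Cycle α} {z : α} (hz : z ∈ c) :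
    ∃ l : List α, c = ((z :: l : List α) : Cycle α) := by
  induction c using Quotient.inductionOn with
  | h L =>
    obtain ⟨s, t, rfl⟩ := List.append_of_mem (Cycle.mem_coe_iff.1 hz)
    refine ⟨t ++ s, ?_⟩
    exact Cycle.coe_eq_coe.2 (List.isRotated_append (l := s) (l' := z :: t))

theorem relDegree_eq_degree {n : ℕ} {f : ℕ → V} (hinj : ∀ i < n, ∀ j < n, f i = f j → i = j)
    (hsurj : ∀ v, ∃ i < n, f i = v) (i : ℕ) :
    relDegree n (fun i j => D.Adj (f i) (f j)) i = D.degree (f i) := by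
  classical
  have himg : (Finset.range n).image f = Finset.univ := by
    ext v
    simpa using hsurj v
  unfold relDegree degree outNeighbors inNeighbors
  rw [Finset.sum_add_distrib, Finset.card_filter, Finset.card_filter, ← himg, Finset.sum_image,
    Finset.sum_image]
  · intro i hi j hj hij
    simp only [Finset.coe_range, Set.mem_Iio] at hi hj
    exact hinj i hi j hj hij
  · intro i hi j hj hij
    simp only [Finset.coe_range, Set.mem_Iio] at hi hj
    exact hinj i hi j hj hij

theorem IsKStrong.exists_arc (hD : D.IsKStrong 2) (v : V) (P : V → Prop) {x y : V} (hx : x ≠ v)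
    (hy : y ≠ v) (hPx : P x) (hPy : ¬ P y) : ∃ a b, a ≠ v ∧ b ≠ v ∧ P a ∧ ¬ P b ∧ D.Adj a b := by
  have hmem : ∀ w, w ≠ v → w ∈ ((({v} : Finset V) : Set V)ᶜ : Set V) := by
    intro w hw
    simpa using hw
  have h1 := hD.2 {v} (by simp) ⟨x, hmem x hx⟩ ⟨y, hmem y hy⟩ (by
    intro h2
    have h3 : x = y := congrArg Subtype.val h2
    rw [h3] at hPx
    exact hPy hPx)
  obtain ⟨⟨p, hp⟩, -⟩ := h1
  obtain ⟨a, b, hab, ha, hb⟩ := exists_rel_of_isChain (P := fun w => P w.1) hp.chain hp.head hp.last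
    hPx hPy
  exact ⟨a, b, by simpa using a.2, by simpa using b.2, ha, hb, hab⟩

/-- The vertices can be numbered `0, 1, …` such that a given path is an initial segment. -/
theorem exists_numbering {z : V} {l : List V} (hl : (z :: l).Nodup) : ∃ f : ℕ → V,
    (∀ i (hi : i < (z :: l).length), f i = (z :: l)[i]) ∧
    (∀ i < Fintype.card V, ∀ j < Fintype.card V, f i = f j → i = j) ∧
    ∀ v, ∃ i < Fintype.card V, f i = v := by
  classical
  set L := (z :: l) ++ (Finset.univ \ (z :: l).toFinset).toList with hL
  have hnd : L.Nodup := by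
    rw [hL, List.nodup_append]
    refine ⟨hl, Finset.nodup_toList _, ?_⟩
    rintro a ha b hb rfl
    rw [Finset.mem_toList, Finset.mem_sdiff, List.mem_toFinset] at hb
    exact hb.2 ha
  have hmem : ∀ v, v ∈ L := by
    intro v
    rw [hL, List.mem_append, Finset.mem_toList, Finset.mem_sdiff, List.mem_toFinset]
    by_cases hv : v ∈ z :: l
    · exact Or.inl hv
    · exact Or.inr ⟨Finset.mem_univ v, hv⟩
  have hlen : L.length = Fintype.card V := by
    rw [← List.toFinset_card_of_nodup hnd, Finset.card_eq_iff_eq_univ]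
    ext v
    simpa using hmem v
  refine ⟨fun i => L.getD i z, ?_, ?_, ?_⟩
  · intro i hi
    simp only
    rw [List.getD_eq_getElem _ _ (by rw [hL, List.length_append]; omega)]
    exact List.getElem_append_left hi
  · intro i hi j hj hij
    simp only at hij
    rw [List.getD_eq_getElem _ _ (by omega), List.getD_eq_getElem _ _ (by omega)] at hij
    exact (List.Nodup.getElem_inj_iff hnd).1 hij
  · intro v
    obtain ⟨i, hi, hv⟩ := List.getElem_of_mem (hmem v)
    refine ⟨i, by omega, ?_⟩
    simp only
    rw [List.getD_eq_getElem _ _ hi, hv]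

end Digraph

theorem theorem6 {V : Type*} [Fintype V] (D : Digraph V) (hD : D.Loopless)
    (n k : ℕ) (hn : 3 ≤ n) (hcard : Fintype.card V = n)
    (hstrong : D.IsKStrong 2)
    (z : V) (hdeg : ∀ v : V, v ≠ z → n + k ≤ D.degree v)
    (hz : (n : ℤ) - k - 4 ≤ D.degree z)
    (hcycle : ∃ c : Cycle V, D.IsCycle c ∧ z ∈ c ∧ (n : ℤ) - k - 2 ≤ c.length) :
    D.IsHamiltonian := by
  classical
  by_contra hham
  obtain ⟨c₀, hc₀, hzc₀, hlen₀⟩ := hcycle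
  -- a longest cycle through `z`
  obtain ⟨c, hc, hzc, hlen, hmax⟩ : ∃ c : Cycle V, D.IsCycle c ∧ z ∈ c ∧
      (n : ℤ) - k - 2 ≤ c.length ∧
      ∀ c' : Cycle V, D.IsCycle c' → z ∈ c' → c'.length ≤ c.length := by
    set P : ℕ → Prop := fun m => ∃ c : Cycle V, D.IsCycle c ∧ z ∈ c ∧ c.length = m with hP
    have hle : ∀ c' : Cycle V, D.IsCycle c' → z ∈ c' → c'.length ≤ Nat.findGreatest P n :=
      fun c' h1 h2 => Nat.le_findGreatest (by rw [← hcard]; exact h1.length_le) ⟨c', h1, h2, rfl⟩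
    obtain ⟨c, h1, h2, h3⟩ : P (Nat.findGreatest P n) :=
      Nat.findGreatest_spec (P := P) (m := c₀.length) (by rw [← hcard]; exact hc₀.length_le)
        ⟨c₀, hc₀, hzc₀, rfl⟩
    refine ⟨c, h1, h2, ?_, by rwa [h3]⟩
    have := hle c₀ hc₀ hzc₀
    omega
  obtain ⟨l, rfl⟩ := Digraph.exists_cons_of_mem hzc
  have hnd : (z :: l).Nodup := Cycle.nodup_coe_iff.1 hc.nodup
  have hch := hc.chain
  rw [Cycle.chain_coe_cons] at hch
  have hl2 : 2 ≤ l.length + 1 := hc.two_le_length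
  have hlen' : (n : ℤ) - k - 2 ≤ (l.length + 1 : ℕ) := hlen
  have hln : l.length + 1 < n := by
    by_contra hcon
    refine hham ⟨_, hc, fun v => ?_⟩
    have h1 : (z :: l).toFinset = Finset.univ := by
      refine Finset.eq_univ_of_card _ (le_antisymm (Finset.card_le_univ _) ?_)
      rw [List.toFinset_card_of_nodup hnd, hcard]
      simpa using hcon
    have h2 := Finset.mem_univ v
    rw [← h1, List.mem_toFinset] at h2
    exact h2
  obtain ⟨f, hf, hinj, hsurj⟩ := Digraph.exists_numbering hnd
  rw [hcard] at hinj hsurj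
  have hf0 : f 0 = z := hf 0 (by simp)
  set R : ℕ → ℕ → Prop := fun i j => D.Adj (f i) (f j) with hR
  have hirr : ∀ i, ¬ R i i := fun i => hD (f i)
  have hdegree : ∀ i, 0 < i → i < n → n + k ≤ relDegree n R i := by
    intro i h1 h2
    rw [Digraph.relDegree_eq_degree hinj hsurj]
    refine hdeg _ fun h3 => ?_
    have := hinj i h2 0 (by omega) (by rw [h3, hf0])
    omega
  obtain ⟨b, hb⟩ : ∃ b, n = l.length + b + 1 := ⟨n - (l.length + 1), by omega⟩
  have hshort : ShortCycles n b R := by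
    intro l' h1 h2 h3
    have hl' : l' ≠ [] := by
      rintro rfl
      simp only [List.nil_append, List.isChain_cons_cons] at h3
      exact hirr 0 h3.1
    have h4 : D.IsCycle (((0 :: l').map f : List V) : Cycle V) := by
      refine ⟨?_, ?_, ?_⟩
      · rw [Cycle.nodup_coe_iff]
        refine List.Nodup.map_on (fun x hx y hy hxy => ?_) h1
        have h5 : ∀ x ∈ 0 :: l', x < n := by
          intro x hx
          rcases List.mem_cons.1 hx with rfl | hx
          · omega
          · exact h2 x hx
        exact hinj x (h5 x hx) y (h5 y hy) hxy
      · have := List.length_pos_iff.2 hl'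
        simp only [List.map_cons, Cycle.length_coe, List.length_cons, List.length_map]
        omega
      · rw [List.map_cons, Cycle.chain_coe_cons]
        have h5 : f 0 :: (l'.map f ++ [f 0]) = (0 :: (l' ++ [0])).map f := by simp
        rw [h5, List.isChain_map]
        exact h3
    have h5 := hmax _ h4 (by rw [Cycle.mem_coe_iff, ← hf0]; simp)
    simp only [List.map_cons, Cycle.length_coe, List.length_cons, List.length_map] at h5
    omega
  have harc : ∀ i < l.length, R i (i + 1) := by
    intro i hi
    have h1 := List.isChain_iff_getElem.1 hch i (by simp; omega)
    have h2 : (z :: (l ++ [z]))[i]'(by simp; omega) = f i := by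
      rw [hf i (by simp; omega)]
      simp only [← List.cons_append]
      exact List.getElem_append_left _
    have h3 : (z :: (l ++ [z]))[i + 1]'(by simp; omega) = f (i + 1) := by
      rw [hf (i + 1) (by simp; omega)]
      simp only [← List.cons_append]
      exact List.getElem_append_left _
    rw [h2, h3] at h1
    exact h1
  have hclose : R l.length 0 := by
    have h1 := List.isChain_iff_getElem.1 hch l.length (by simp)
    have h2 : (z :: (l ++ [z]))[l.length]'(by simp) = f l.length := by
      rw [hf l.length (by simp)]
      simp only [← List.cons_append]
      exact List.getElem_append_left _
    have h3 : (z :: (l ++ [z]))[l.length + 1]'(by simp) = f 0 := by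
      rw [hf0]
      simp
    rw [h2, h3] at h1
    exact h1
  -- a vertex off the cycle has degree at most `2 n - l.length - 3`, which determines `b`
  have hbk : b = k + 2 := by
    have h1 := relDegree_add_card_le (p := l.length) (y := l.length + 1) (by omega) (by omega)
      (hirr _) (fun i hi => hshort.not_insertable hb harc hclose (by omega) (by omega) hi)
      (hshort.not_insertable_last hb harc (by omega) (by omega)) ∅ (by simp)
    have h2 := hdegree (l.length + 1) (by omega) (by omega)
    omega
  have hrel : LongCycle n b l.length R := by
    refine ⟨⟨by omega, by omega, hirr, ?_, ?_, ?_, hshort⟩, hb, harc, hclose⟩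
    · intro i h1 h2
      have := hdegree i h1 h2
      omega
    · rw [Digraph.relDegree_eq_degree hinj hsurj, hf0]
      omega
    · rintro v hv U ⟨u, hu, huv, hU⟩ ⟨w, hw, hwv, hW⟩
      obtain ⟨x, y, h1, h2, h3, h4, h5⟩ := hstrong.exists_arc (f v)
        (fun x => ∃ i < n, f i = x ∧ U i) (x := f u) (y := f w)
        (fun h => huv (hinj u hu v hv h)) (fun h => hwv (hinj w hw v hv h)) ⟨u, hu, rfl, hU⟩ (by
          rintro ⟨i, hi, hiw, hUi⟩
          exact hW (hinj i hi w hw hiw ▸ hUi))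
      obtain ⟨i, hi, rfl, hUi⟩ := h3
      obtain ⟨m, hm, rfl⟩ := hsurj y
      exact ⟨i, m, hi, hm, fun h => h1 (by rw [h]), fun h => h2 (by rw [h]), hUi,
        fun hUm => h4 ⟨m, hm, rfl, hUm⟩, h5⟩
  exact hrel.contradiction
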